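/- **Setting.** A 3-IET is given by lengths $\ell_1,\ell_2,\ell_3>0$ and a permutation $\pi$ of $\{1,2,3\}$: on $I_j=[\sum_{k<j}\ell_k,\sum_{k\le j}\ell_k)$ it is $T(x)=x-\sum_{k<j}\ell_k+\sum_{\pi(k)<\pi(j)}\ell_k$. Let $\alpha$ be irrational, $R(x)=x+\alpha \pmod 1$ on $[0,1)$, and $J=[0,z)\subset[0,1]$. Let $T$ be a 3-IET with $\ell_1+\ell_2+\ell_3=z$ which is the induced (first return) map of $R$ on $J$, and assume that $x\notin J$ implies $Rx\in J$. Write $a_0,a_1,\dots$ for the continued fraction coefficients of $\alpha$ and $q_0=1,q_1=a_1,\dots$ for the denominators of its convergents, $\|x\|$ for the distance from $x$ to $\mathbb Z$, $\lambda$ for Lebesgue measure, $d(x,y)=\min\{|x-y|,1-|x-y|\}$ on $[0,1)$, and $\psi_r(x)=\sum_{i=0}^{r-1}\chi_J(R^i x)$ for $x\in[0,1)$. Consider the flat torus $\mathbb R^2/(\mathbb Z(1,0)+\mathbb Z(-\alpha,1))$ with the two marked points $(0,0)$ and $(z,0)$. **Assumptions (A0)–(A9).** There are constants $C_1,C_2,C_3,C_4>1$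 and $\eta_0>0$, numbers $\hat c_\eta>0$ for $0<\eta<\eta_0$ (depending on $\eta$ only) and $c_\ell>0$ for $\ell\in\mathbb N$ (depending on $\ell$ only) such that for all $\ell\in\mathbb N$, $0<\eta<\eta_0$ and $0<c<c_\ell$ there are $k_c\in\mathbb N$ and sequences of natural numbers $L_i\to\infty$, $k_i\to\infty$ such that for all $i$ (except that (A6) concerns the whole sequence): - (A0) $q_{k_i-1}<cL_i<q_{k_i}$. - (A1) $a_{k_i}<C_1$. - (A2) $a_{k_i+1}<C_2$. - (A3) $a_{k_i+2}<C_3$. - (A4) Every (upward) vertical trajectory on the torus from either marked point to the open $\|q_{k_i}\alpha\|$-neighborhood of the other marked point has length at least $q_{k_i}/C_4$. - (A5) There is $u_i$ with $\lambda(\psi_{L_i}^{-1}(u_i))>\hat c_\eta$ and either $\lambda(\psi_{L_i}^{-1}((-\infty,u_i)))<\eta\hat c_\eta$ or $\lambda(\psi_{L_i}^{-1}((u_i,\infty)))<\eta\hat c_\eta$. - (A6) $\lim_{i\to\infty}\int_0^1 d(R^{L_i}x,x)\,d\lambda(x)=0$. - (A7) $L_i>q_{k_i+\ell}$. - (A8)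 $\max\{j:\psi_{L_i}^{-1}(j)\ne\emptyset\}-\min\{j:\psi_{L_i}^{-1}(j)\ne\emptyset\}<k_c$. - (A9) There is $v_i$ with $q_{v_i}\le L_i<q_{v_i+1}$ and either $L_i=q_{v_i}$, or $a_{v_i+1}>4$ and $L_i=pq_{v_i}$ for some integer $0\le p\le\lfloor a_{v_i+1}/4\rfloor$. **Disjointness.** Two probability-measure-preserving systems $(X,\mu,S)$ and $(Y,\nu,S')$ are disjoint if $\mu\times\nu$ is the only $S\times S'$-invariant measure on $X\times Y$ with marginals $\mu$ and $\nu$. Powers of $T$ are considered as maps of $J$ with normalized Lebesgue measure. **Theorem.** If $T$ is a 3-IET as above that satisfies (A0)–(A9), then there exists $\kappa>1$ such that for every $n>0$ the set $B_n=\{0<m<n : T^m\text{ is not disjoint from }T^n\}$ has the following property: if $m_1,m_2\in B_n$ and $m_1<m_2$, then $\frac{m_2}{m_1}>\kappa$. -/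

import Mathlib

open MeasureTheory Filter Set

/-! ### Interval exchange transformations, rotations and induced maps -/

/-- The `j`-th interval `I_j` cut out of `[0, ∑ len)` by the lengths `len`. -/
def ietPiece {d : ℕ} (len : Fin d → ℝ) (j : Fin d) : Set ℝ :=
  Set.Ico (∑ k ∈ Finset.univ.filter (fun k => k < j), len k)
    (∑ k ∈ Finset.univ.filter (fun k => k ≤ j), len k)

/-- The interval exchange transformation with permutation `π` and lengths `len`:
`T x = x - ∑_{k < j} len k + ∑_{π k < π j} len k` for `x ∈ I_j`. (The intervals are pairwise
disjoint, so at most one summand of the outer sum is non-zero.) It is a map of `[0, ∑ len)`,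
extended by the identity to the rest of the line. -/
noncomputable def ietMap {d : ℕ} (π : Equiv.Perm (Fin d)) (len : Fin d → ℝ) (x : ℝ) : ℝ :=
  x + ∑ j, (ietPiece len j).indicator
    (fun _ => -(∑ k ∈ Finset.univ.filter (fun k => k < j), len k)
      + ∑ k ∈ Finset.univ.filter (fun k => π k < π j), len k) x

/-- The rotation `R x = x + α (mod 1)` of `[0, 1)`. -/
noncomputable def rot (α x : ℝ) : ℝ := Int.fract (x + α)

/-- On `J`, the map `T` is the induced (first return) map of `R`. -/
def IsInducedMap (R : ℝ → ℝ) (J : Set ℝ) (T : ℝ → ℝ) : Prop :=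
  ∀ x ∈ J, ∃ n : ℕ, 0 < n ∧ (∀ k : ℕ, 0 < k → k < n → R^[k] x ∉ J) ∧
    R^[n] x ∈ J ∧ T x = R^[n] x

/-! ### Joinings and disjointness -/

/-- `σ` is a joining of the measure preserving systems `(X, μ, S)` and `(Y, ν, T)`. -/
structure IsJoining {X Y : Type*} [MeasurableSpace X] [MeasurableSpace Y]
    (μ : Measure X) (ν : Measure Y) (S : X → X) (T : Y → Y) (σ : Measure (X × Y)) : Prop where
  map_fst : σ.map Prod.fst = μ
  map_snd : σ.map Prod.snd = ν
  invariant : MeasurePreserving (Prod.map S T) σ σ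

/-- Disjointness in the sense of Furstenberg: the product measure is the only joining. -/
def DisjointSystems {X Y : Type*} [MeasurableSpace X] [MeasurableSpace Y]
    (μ : Measure X) (ν : Measure Y) (S : X → X) (T : Y → Y) : Prop :=
  ∀ σ : Measure (X × Y), IsJoining μ ν S T σ → σ = μ.prod ν

/-- Lebesgue measure on `[0, z)`, normalized to a probability measure. -/
noncomputable def lebJ (z : ℝ) : Measure ℝ :=
  ProbabilityTheory.cond volume (Set.Ico 0 z)

/-- `B_n = {0 < m < n : T^m is not disjoint from T^n}` for a map `T` of `[0, z)`. -/
def nonDisjointPowers (z : ℝ) (T : ℝ → ℝ) (n : ℕ) : Set ℕ :=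
  {m | 0 < m ∧ m < n ∧ ¬ DisjointSystems (lebJ z) (lebJ z) T^[m] T^[n]}

/-! ### Continued fractions -/

/-- The continued fraction coefficients `a_0, a_1, …` of `α`. -/
noncomputable def cfA (α : ℝ) : ℕ → ℝ
  | 0 => (GenContFract.of α).h
  | k + 1 => ((GenContFract.of α).partDens.get? k).getD 0

/-- The denominators `q_0 = 1, q_1 = a_1, …` of the continued fraction convergents of `α`. -/
noncomputable def cfQ (α : ℝ) (k : ℕ) : ℝ := (GenContFract.of α).dens k

/-- The distance `‖x‖` of `x` to the nearest integer. -/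
noncomputable def distInt (x : ℝ) : ℝ := |x - round x|

/-! ### The diophantine assumptions -/

/-- `ψ_r(x) = ∑_{i < r} χ_J(R^i x)` with `J = [0, z)`. -/
noncomputable def visits (α z : ℝ) (r : ℕ) (x : ℝ) : ℕ :=
  ∑ i ∈ Finset.range r, (Set.Ico 0 z).indicator (fun _ => 1) ((rot α)^[i] x)

/-- The set `ψ_r⁻¹(U)` for the function `ψ_r` on `[0, 1)`. -/
def visitsPreimage (α z : ℝ) (r : ℕ) (U : Set ℕ) : Set ℝ :=
  {x | x ∈ Set.Ico (0 : ℝ) 1 ∧ visits α z r x ∈ U}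

/-- The distance `d(x, y) = min {|x - y|, 1 - |x - y|}` on `[0, 1)`. -/
noncomputable def circDist (x y : ℝ) : ℝ := min |x - y| (1 - |x - y|)

/-- The plane is `ℂ`, horizontal direction `1`, vertical direction `I`. On the flat torus
`ℂ / (ℤ + ℤ (-α + I))`, the point represented by `p` lies in the open neighborhood of radius
`r` of the point represented by `p'`. -/
def InTorusNhd (α r : ℝ) (p p' : ℂ) : Prop :=
  ∃ m n : ℤ, ‖p - (p' + m + n * (-(α : ℂ) + Complex.I))‖ < r

/-- On the torus `ℂ / (ℤ + ℤ (-α + I))`, every vertical trajectory from `p` to the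
neighborhood of radius `r` of `p'` has length at least `D`. -/
def VerticalLengthGE (α r : ℝ) (p p' : ℂ) (D : ℝ) : Prop :=
  ∀ s : ℝ, 0 ≤ s → InTorusNhd α r (p + s * Complex.I) p' → D ≤ s

/-- The assumptions on one pair `L = L_i`, `k = k_i`, all except the limit (A6). -/
structure IndexConditions (α z C₁ C₂ C₃ C₄ η chat c : ℝ) (l kc L k : ℕ) : Prop where
  A0 : cfQ α (k - 1) < c * L ∧ c * L < cfQ α k
  A1 : cfA α k < C₁
  A2 : cfA α (k + 1) < C₂
  A3 : cfA α (k + 2) < C₃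
  /-- The marked points are the endpoints `0` and `z` of the horizontal segment; the bound
  holds from either one to the other. -/
  A4 : VerticalLengthGE α (distInt (cfQ α k * α)) 0 z (cfQ α k / C₄) ∧
    VerticalLengthGE α (distInt (cfQ α k * α)) z 0 (cfQ α k / C₄)
  A5 : ∃ u : ℕ,
    (chat < volume.real (visitsPreimage α z L {u}) ∧
      volume.real (visitsPreimage α z L (Set.Iio u)) < η * chat) ∨
    (chat < volume.real (visitsPreimage α z L {u}) ∧
      volume.real (visitsPreimage α z L (Set.Ioi u)) < η * chat)
  A7 : cfQ α (k + l) < L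
  /-- The maximal minus the minimal value of `ψ_L` is less than `kc`. -/
  A8 : ∀ j j' : ℕ, (visitsPreimage α z L {j}).Nonempty → (visitsPreimage α z L {j'}).Nonempty →
    (j : ℤ) - (j' : ℤ) < (kc : ℤ)
  A9 : ∃ v : ℕ, cfQ α v ≤ L ∧ (L : ℝ) < cfQ α (v + 1) ∧
    ((L : ℝ) = cfQ α v ∨
      (4 < cfA α (v + 1) ∧ ∃ p : ℕ, (p : ℤ) ≤ ⌊cfA α (v + 1) / 4⌋ ∧ (L : ℝ) = p * cfQ α v))

/-- The assumptions (A0)-(A9) on the rotation `R` by `α` and the interval `J = [0, z)`. The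
constant `chat η` depends on `η` only, and the threshold `cl l` on `l` only. -/
def SatisfiesA (α z : ℝ) : Prop :=
  ∃ C₁ C₂ C₃ C₄ : ℝ, 1 < C₁ ∧ 1 < C₂ ∧ 1 < C₃ ∧ 1 < C₄ ∧
  ∃ η₀ : ℝ, 0 < η₀ ∧
  ∃ (chat : ℝ → ℝ) (cl : ℕ → ℝ),
    (∀ η, 0 < η → η < η₀ → 0 < chat η) ∧ (∀ l, 0 < cl l) ∧
    ∀ (l : ℕ) (η : ℝ), 0 < η → η < η₀ →
      ∀ c : ℝ, 0 < c → c < cl l →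
        ∃ (kc : ℕ) (L k : ℕ → ℕ), Tendsto L atTop atTop ∧ Tendsto k atTop atTop ∧
          (∀ i, IndexConditions α z C₁ C₂ C₃ C₄ η (chat η) c l kc (L i) (k i)) ∧
          -- (A6)
          Tendsto (fun i => ∫ x in (0 : ℝ)..1, circDist ((rot α)^[L i] x) x) atTop (nhds 0)

/-- `q` is a denominator, with numerator `p`, that approximates `α` at a scale where the rotation
by `α` with the marked points `0` and `z` has geometry bounded in terms of `κ`. -/
structure GoodScale (α z κ : ℝ) (q : ℕ) (p : ℤ) : Prop where
  pos : 0 < q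
  coprime : IsCoprime (q : ℤ) p
  lower : κ ≤ q * |q * α - p|
  upper : q * |q * α - p| < 1
  gap : ∀ j l : ℤ, j ≠ 0 → |(j : ℝ)| < (1 + κ) * q → |q * α - p| ≤ |j * α - l|
  sep : ∀ j l : ℤ, |(j : ℝ)| < κ * q → |q * α - p| ≤ |j * α - z - l|

section ContinuedFraction

open GenContFract

theorem Irrational.exists_stream {α : ℝ} (hα : Irrational α) (k : ℕ) :
    ∃ ifp, IntFractPair.stream α k = some ifp ∧ Irrational ifp.fr := by
  induction k with
  | zero =>
    refine ⟨_, IntFractPair.stream_zero α, ?_⟩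
    exact hα.sub_intCast ⌊α⌋
  | succ k ih =>
    obtain ⟨ifp, h, hirr⟩ := ih
    refine ⟨_, IntFractPair.stream_succ_of_some h hirr.ne_zero, ?_⟩
    exact hirr.inv.sub_intCast ⌊ifp.fr⁻¹⌋

/-- The convergents of an irrational number in integers, shifted by one. -/
theorem Irrational.exists_convergents {α : ℝ} (hα : Irrational α) :
    ∃ (P Q a : ℕ → ℤ) (x : ℕ → ℝ),
      Q 0 = 0 ∧ Q 1 = 1 ∧ P 0 = 1 ∧
      (∀ k, Q (k + 2) = a k * Q (k + 1) + Q k) ∧ (∀ k, P (k + 2) = a k * P (k + 1) + P k) ∧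
      (∀ k, 1 ≤ a k) ∧ (∀ k, 1 < x k ∧ x k < a k + 1) ∧
      (∀ k, cfQ α k = Q (k + 1)) ∧ (∀ k, cfA α (k + 1) = a k) ∧
      (∀ k, Q (k + 1) * α - P (k + 1) = (-1) ^ k / (x k * Q (k + 1) + Q k)) := by
  choose s hs hirr using hα.exists_stream
  have hfr : ∀ k, 0 < (s k).fr ∧ (s k).fr < 1 := fun k => by
    have := IntFractPair.nth_stream_fr_nonneg_lt_one (hs k)
    exact ⟨lt_of_le_of_ne this.1 (hirr k).ne_zero.symm, this.2⟩
  have hget : ∀ k, (GenContFract.of α).s.get? k = some ⟨1, (⌊(s k).fr⁻¹⌋ : ℝ)⟩ := fun k =>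
    get?_of_eq_some_of_get?_intFractPair_stream_fr_ne_zero (hs k) (hirr k).ne_zero
  set a : ℕ → ℤ := fun k => ⌊(s k).fr⁻¹⌋ with ha
  have hrec : ∀ k, (GenContFract.of α).contsAux (k + 2) =
      ⟨a k * ((GenContFract.of α).contsAux (k + 1)).a + ((GenContFract.of α).contsAux k).a,
       a k * ((GenContFract.of α).contsAux (k + 1)).b + ((GenContFract.of α).contsAux k).b⟩ := by
    intro k
    rw [contsAux_recurrence (hget k) rfl rfl]
    simp [ha]
  let V : ℕ → (ℤ × ℤ) × (ℤ × ℤ) := fun k =>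
    Nat.rec (((1 : ℤ), (0 : ℤ)), (⌊α⌋, (1 : ℤ)))
      (fun k v => (v.2, (a k * v.2.1 + v.1.1, a k * v.2.2 + v.1.2))) k
  have hV : ∀ k, (GenContFract.of α).contsAux k = ⟨((V k).1.1 : ℝ), ((V k).1.2 : ℝ)⟩ ∧
      (GenContFract.of α).contsAux (k + 1) = ⟨((V k).2.1 : ℝ), ((V k).2.2 : ℝ)⟩ := by
    intro k
    induction k with
    | zero =>
      constructor
      · simp [V, contsAux]
      · simp [V, contsAux, of_h_eq_floor]
    | succ k ih =>
      refine ⟨ih.2, ?_⟩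
      rw [hrec k, ih.1, ih.2]
      simp [V]
  have hcQ : ∀ k, ((GenContFract.of α).contsAux k).b = ((V k).1.2 : ℝ) := fun k => by
    rw [(hV k).1]
  have hcP : ∀ k, ((GenContFract.of α).contsAux k).a = ((V k).1.1 : ℝ) := fun k => by
    rw [(hV k).1]
  have ha1 : ∀ k, 1 ≤ a k := fun k => by
    rw [ha, Int.le_floor]
    simpa using (one_lt_inv₀ (hfr k).1).2 (hfr k).2 |>.le
  have hQ2 : ∀ k, (V (k + 2)).1.2 = a k * (V (k + 1)).1.2 + (V k).1.2 := fun k => rfl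
  have hQpos : ∀ k, 0 < (V (k + 1)).1.2 ∧ 0 ≤ (V k).1.2 := by
    intro k
    induction k with
    | zero => simp [V]
    | succ k ih =>
      refine ⟨?_, ih.1.le⟩
      rw [hQ2]
      nlinarith [ha1 k, ih.1, ih.2]
  refine ⟨fun k => (V k).1.1, fun k => (V k).1.2, a, fun k => (s k).fr⁻¹, rfl, rfl, rfl,
    fun k => rfl, fun k => rfl, ha1, fun k => ⟨(one_lt_inv₀ (hfr k).1).2 (hfr k).2,
      Int.lt_floor_add_one _⟩, fun k => ?_, fun k => ?_, fun k => ?_⟩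
  · exact hcQ (k + 1)
  · simp only [cfA, partDens, Stream'.Seq.map_get?, hget, Option.map_some, Option.getD_some, ha]
  · have h := sub_convs_eq (hs k)
    simp only [(hirr k).ne_zero, if_false] at h
    have hc : (GenContFract.of α).convs k = ((V (k + 1)).1.1 : ℝ) / ((V (k + 1)).1.2 : ℝ) := by
      have : (GenContFract.of α).convs k = ((GenContFract.of α).contsAux (k + 1)).a /
          ((GenContFract.of α).contsAux (k + 1)).b := rfl
      rw [this, hcP, hcQ]
    rw [hc, hcQ, hcQ] at h
    have h1 : (0 : ℝ) < ((V (k + 1)).1.2 : ℝ) := by exact_mod_cast (hQpos k).1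
    have h0 : (0 : ℝ) ≤ ((V k).1.2 : ℝ) := by exact_mod_cast (hQpos k).2
    have hx : 0 < (s k).fr⁻¹ := inv_pos.2 (hfr k).1
    have hD : 0 < (s k).fr⁻¹ * ((V (k + 1)).1.2 : ℝ) + ((V k).1.2 : ℝ) := by positivity
    have hαe : α = ((V (k + 1)).1.1 : ℝ) / ((V (k + 1)).1.2 : ℝ) + (-1) ^ k /
      (((V (k + 1)).1.2 : ℝ) * ((s k).fr⁻¹ * ((V (k + 1)).1.2 : ℝ) + ((V k).1.2 : ℝ))) := by
      linarith
    rw [eq_div_iff hD.ne']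
    conv_lhs => rw [hαe]
    generalize ((s k).fr⁻¹ * ((V (k + 1)).1.2 : ℝ) + ((V k).1.2 : ℝ)) = D at *
    field_simp
    ring

/-- Best approximation: a vector `(q, p)` that belongs to a unimodular pair `(q, p)`, `(q', p')`
approximating `α` from opposite sides beats all `(j, l)` with `j < q'`. -/
theorem abs_le_abs_of_det {α : ℝ} {q q' p p' s : ℤ} (hq : 0 < q) (hq' : 0 < q')
    (hs : s * s = 1) (hdet : p * q' - p' * q = s) (hsign : (q * α - p) * (q' * α - p') < 0)
    {j l : ℤ} (hj : j ≠ 0) (hjq : |j| < q') : |q * α - p| ≤ |j * α - l| := by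
  obtain ⟨x, y, hx, hy⟩ : ∃ x y : ℤ, j = x * q + y * q' ∧ l = x * p + y * p' := by
    refine ⟨-s * (j * p' - l * q'), s * (j * p - l * q), ?_, ?_⟩
    · linear_combination (-j) * hs + (-s * j) * hdet
    · linear_combination (-l) * hs + (-s * l) * hdet
  have hval : (j : ℝ) * α - l = x * (q * α - p) + y * (q' * α - p') := by
    rw [hx, hy]; push_cast; ring
  have key : x ≠ 0 ∧ x * y ≤ 0 := by
    rw [abs_lt] at hjq
    by_cases hy0 : y = 0
    · subst hy0
      refine ⟨?_, by simp⟩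
      rintro rfl
      simp at hx
      exact hj hx
    · refine ⟨?_, ?_⟩
      · rintro rfl
        rcases lt_or_gt_of_ne hy0 with h | h <;> nlinarith
      · by_contra! h
        rcases pos_and_pos_or_neg_and_neg_of_mul_pos h with h | h <;> nlinarith [h.1, h.2]
  have hx1 : (1 : ℝ) ≤ |(x : ℝ)| := by
    exact_mod_cast Int.one_le_abs key.1
  rw [hval]
  generalize (q : ℝ) * α - p = D at *
  generalize (q' : ℝ) * α - p' = D' at *
  have hxy : (x : ℝ) * y ≤ 0 := by exact_mod_cast key.2
  have h0 : 0 ≤ (x * D) * (y * D') := by nlinarith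
  have h1 : |(x : ℝ) * D + y * D'| = |x * D| + |y * D'| :=
    (abs_add_eq_add_abs_iff _ _).2 (mul_nonneg_iff.1 h0)
  rw [h1, abs_mul]
  nlinarith [abs_nonneg D, abs_nonneg ((y : ℝ) * D')]

theorem sep_of_verticalLengthGE {α z r D : ℝ} (h : VerticalLengthGE α r 0 z D ∧
    VerticalLengthGE α r z 0 D) (j l : ℤ) (hj : |(j : ℝ)| < D) : r ≤ |j * α - z - l| := by
  by_contra! hlt
  have key : ∀ (p p' : ℂ) (s : ℤ) (w : ℤ), VerticalLengthGE α r p p' D → 0 ≤ s →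
      ‖p + s * Complex.I - (p' + w + s * (-(α : ℂ) + Complex.I))‖ < r → D ≤ s := by
    intro p p' s w hV hs hlt
    refine hV s (by exact_mod_cast hs) ⟨w, s, ?_⟩
    push_cast
    exact hlt
  rcases le_total 0 j with hj0 | hj0
  · have := key 0 z j l h.1 hj0 (by
      have e : (0 : ℂ) + j * Complex.I - (z + l + j * (-(α : ℂ) + Complex.I)) =
        ((j * α - z - l : ℝ) : ℂ) := by push_cast; ring
      rw [e, Complex.norm_real]; exact hlt)
    exact absurd (lt_of_le_of_lt (le_abs_self _) hj) (not_lt.2 this)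
  · have := key z 0 (-j) (-l) h.2 (by omega) (by
      have e : (z : ℂ) + (-j : ℤ) * Complex.I - (0 + (-l : ℤ) + (-j : ℤ) * (-(α : ℂ) + Complex.I)) =
        ((-(j * α - z - l) : ℝ) : ℂ) := by push_cast; ring
      rw [e, Complex.norm_real, norm_neg]; exact hlt)
    push_cast at this
    exact absurd (lt_of_le_of_lt (neg_le_abs _) hj) (not_lt.2 this)

theorem round_eq_of_abs_sub_lt {x : ℝ} {p : ℤ} (h : |x - p| < 1 / 2) : round x = p := by
  rw [abs_lt] at h
  rw [round_eq, Int.floor_eq_iff]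
  constructor <;> linarith

/-- Bounded partial quotients around `q_k` together with the separation of the marked points at
the scale `q_k` make `q_k` a good scale. -/
theorem SatisfiesA.exists_goodScale {α z : ℝ} (hα : Irrational α) (h : SatisfiesA α z) :
    ∃ κ : ℝ, 0 < κ ∧ κ < 1 ∧ ∀ N : ℕ, ∃ (q : ℕ) (p : ℤ), N < q ∧ GoodScale α z κ q p := by
  obtain ⟨C₁, C₂, C₃, C₄, hC₁, hC₂, -, hC₄, η₀, hη₀, chat, cl, -, hcl, h⟩ := h
  obtain ⟨kc, L, k, -, hk, hI, -⟩ := h 0 (η₀ / 2) (by linarith) (by linarith) (cl 0 / 2)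
    (by linarith [hcl 0]) (by linarith [hcl 0])
  obtain ⟨P, Q, a, x, hQ0, hQ1, hP0, hQ, hP, ha, hx, hcQ, hcA, hD⟩ := hα.exists_convergents
  have hQpos : ∀ k, 0 < Q (k + 1) ∧ 0 ≤ Q k := by
    intro k
    induction k with
    | zero => simp [hQ0, hQ1]
    | succ k ih =>
      refine ⟨?_, ih.1.le⟩
      rw [hQ]
      nlinarith [ha k, ih.1, ih.2]
  have hmono : ∀ k, Q k ≤ Q (k + 1) := by
    intro k
    rcases k with _ | k
    · simp [hQ0, hQ1]
    · rw [hQ]; nlinarith [ha k, (hQpos k).1, (hQpos k).2]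
  have hgrow : ∀ k : ℕ, (k : ℤ) ≤ Q (k + 1) := by
    intro k
    induction k with
    | zero => simp [hQ1]
    | succ k ih =>
      rcases k with _ | k
      · have : 0 < Q 2 := (hQpos 1).1
        push_cast
        omega
      · rw [hQ (k + 1)]
        push_cast at ih ⊢
        nlinarith [ha (k + 1), (hQpos k).1, (hQpos (k + 1)).1]
  have hdet : ∀ k, P (k + 1) * Q (k + 2) - P (k + 2) * Q (k + 1) = (-1) ^ (k + 1) := by
    have : ∀ k, P k * Q (k + 1) - P (k + 1) * Q k = (-1) ^ k := by
      intro k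
      induction k with
      | zero => simp [hQ0, hQ1, hP0]
      | succ k ih => rw [hQ, hP, pow_succ, ← ih]; ring
    exact fun k => this (k + 1)
  obtain ⟨κ, hκ, hκ1, hκ2, hκ3, hκ4⟩ : ∃ κ : ℝ, 0 < κ ∧ κ < 1 ∧ κ * (C₁ + 1) ≤ 1 ∧
      κ * (C₂ + 2) ≤ 1 ∧ κ * C₄ ≤ 1 := by
    have hE : 0 < C₁ + C₂ + C₄ + 2 := by linarith
    refine ⟨1 / (C₁ + C₂ + C₄ + 2), by positivity, ?_, ?_, ?_, ?_⟩
    · rw [div_lt_one hE]; linarith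
    all_goals rw [div_mul_eq_mul_div, div_le_one hE]; linarith
  refine ⟨κ, hκ, hκ1, fun N => ?_⟩
  obtain ⟨i, hi⟩ := (hk.eventually (eventually_ge_atTop (N + 1))).exists
  obtain ⟨m, hm⟩ : ∃ m, k i = m + 1 := ⟨k i - 1, by omega⟩
  have hc := hI i
  rw [hm] at hc
  have hA1 : (a m : ℝ) < C₁ := by rw [← hcA]; exact hc.A1
  have hA2 : (a (m + 1) : ℝ) < C₂ := by rw [← hcA]; exact hc.A2
  have hA4 := hc.A4
  rw [hcQ] at hA4
  have hQm : Q (m + 2) = a m * Q (m + 1) + Q m := hQ m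
  have hq0 : 0 < Q (m + 2) := (hQpos (m + 1)).1
  have hqm0 : 0 < Q (m + 1) := (hQpos m).1
  have hN : N < (Q (m + 2)).toNat := by
    have := hgrow (m + 1)
    rw [show m + 1 + 1 = m + 2 from rfl] at this
    push_cast at this
    omega
  have hcast : (((Q (m + 2)).toNat : ℕ) : ℝ) = (Q (m + 2) : ℝ) := by
    have : (((Q (m + 2)).toNat : ℕ) : ℤ) = Q (m + 2) := Int.toNat_of_nonneg hq0.le
    exact_mod_cast this
  have hq : (1 : ℝ) ≤ Q (m + 2) := by exact_mod_cast hq0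
  have hqm : (1 : ℝ) ≤ Q (m + 1) := by exact_mod_cast hqm0
  have hx1 := (hx (m + 1)).1
  have hx2 := (hx (m + 1)).2
  have hDen : 0 < x (m + 1) * Q (m + 2) + Q (m + 1) := by nlinarith
  have hδ : |(Q (m + 2) : ℝ) * α - P (m + 2)| = 1 / (x (m + 1) * Q (m + 2) + Q (m + 1)) := by
    have := hD (m + 1)
    rw [show m + 1 + 1 = m + 2 from rfl] at this
    rw [this, abs_div, abs_pow, abs_neg, abs_one, one_pow, abs_of_pos hDen]
  have hmonoR : (Q (m + 1) : ℝ) ≤ Q (m + 2) := by exact_mod_cast hmono (m + 1)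
  refine ⟨(Q (m + 2)).toNat, P (m + 2), hN, ?_, ?_, ?_, ?_, ?_, ?_⟩
  · omega
  · rw [Int.toNat_of_nonneg hq0.le]
    have hd := hdet (m + 1)
    rw [show m + 1 + 1 = m + 2 from rfl, show m + 1 + 2 = m + 3 from rfl] at hd
    have hsq : ((-1 : ℤ) ^ (m + 2)) * (-1) ^ (m + 2) = 1 := by
      rw [← mul_pow]; norm_num
    refine ⟨-(-1) ^ (m + 2) * P (m + 3), (-1) ^ (m + 2) * Q (m + 3), ?_⟩
    linear_combination ((-1 : ℤ) ^ (m + 2)) * hd + hsq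
  · rw [hcast, hδ, mul_one_div, le_div_iff₀ hDen]
    have h1 : x (m + 1) * Q (m + 2) + Q (m + 1) ≤ (C₂ + 2) * Q (m + 2) := by nlinarith
    calc κ * (x (m + 1) * Q (m + 2) + Q (m + 1)) ≤ κ * ((C₂ + 2) * Q (m + 2)) := by gcongr
      _ = (κ * (C₂ + 2)) * Q (m + 2) := by ring
      _ ≤ Q (m + 2) := by nlinarith
  · rw [hcast, hδ, mul_one_div, div_lt_one hDen]
    nlinarith
  · intro j l hj hjq
    rw [hcast] at hjq ⊢
    have hs1 := hD (m + 1)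
    have hs2 := hD (m + 2)
    rw [show m + 1 + 1 = m + 2 from rfl] at hs1
    rw [show m + 2 + 1 = m + 3 from rfl] at hs2
    have hd := hdet (m + 1)
    rw [show m + 1 + 1 = m + 2 from rfl, show m + 1 + 2 = m + 3 from rfl] at hd
    have hq3 := (hQpos (m + 2)).1
    have hq3' : (1 : ℝ) ≤ Q (m + 3) := by exact_mod_cast hq3
    have hDen2 : 0 < x (m + 2) * Q (m + 3) + Q (m + 2) := by nlinarith [(hx (m + 2)).1]
    have hsq : ((-1 : ℤ) ^ (m + 2)) * (-1) ^ (m + 2) = 1 := by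
      rw [← mul_pow]; norm_num
    refine abs_le_abs_of_det hq0 hq3 hsq hd ?_ hj ?_
    · rw [hs1, hs2, div_mul_div_comm]
      refine div_neg_of_neg_of_pos ?_ (mul_pos hDen hDen2)
      rw [← pow_add, show m + 1 + (m + 2) = 2 * (m + 1) + 1 by ring, pow_succ, pow_mul]
      norm_num
    · have h3 : (Q (m + 3) : ℝ) = a (m + 1) * Q (m + 2) + Q (m + 1) := by
        exact_mod_cast hQ (m + 1)
      have h2 : (Q (m + 2) : ℝ) = a m * Q (m + 1) + Q m := by exact_mod_cast hQm
      have h0 : (Q m : ℝ) ≤ Q (m + 1) := by exact_mod_cast hmono m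
      have ha1 : (1 : ℝ) ≤ a (m + 1) := by exact_mod_cast ha (m + 1)
      have hb : (Q (m + 2) : ℝ) ≤ (C₁ + 1) * Q (m + 1) := by nlinarith
      have hκq : κ * Q (m + 2) ≤ Q (m + 1) := by
        calc κ * Q (m + 2) ≤ κ * ((C₁ + 1) * Q (m + 1)) := by gcongr
          _ = (κ * (C₁ + 1)) * Q (m + 1) := by ring
          _ ≤ Q (m + 1) := by nlinarith
      have : |(j : ℝ)| < Q (m + 3) := by nlinarith
      exact_mod_cast this
  · intro j l hjq
    rw [hcast] at hjq ⊢
    have hround : round ((Q (m + 2) : ℝ) * α) = P (m + 2) := by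
      apply round_eq_of_abs_sub_lt
      rw [hδ]
      apply one_div_lt_one_div_of_lt <;> nlinarith
    rw [distInt, hround] at hA4
    refine sep_of_verticalLengthGE hA4 j l (lt_of_lt_of_le hjq ?_)
    rw [le_div_iff₀ (by linarith)]
    nlinarith

end ContinuedFraction

section Couplings

set_option linter.unusedSectionVars false

variable {X : Type*} [MeasurableSpace X]

/-- Measurable sets as a type. -/
abbrev MSet (X : Type*) [MeasurableSpace X] := {s : Set X // MeasurableSet s}

/-- The preimage of a measurable set under the `k`-th iterate of a measurable map. -/
def MSet.pre {T : X → X} (hT : Measurable T) (k : ℕ) (A : MSet X) : MSet X :=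
  ⟨T^[k] ⁻¹' A, (hT.iterate k) A.2⟩

theorem MSet.pre_add {T : X → X} (hT : Measurable T) (j k : ℕ) (A : MSet X) :
    A.pre hT (j + k) = (A.pre hT j).pre hT k :=
  Subtype.ext (by simp [MSet.pre, Function.iterate_add, preimage_comp])

/-- The whole space as a measurable set. -/
def MSet.top : MSet X := ⟨univ, .univ⟩

theorem MSet.top_inter (A : MSet X) : MSet.top ∩ A = A := Subtype.ext (univ_inter _)

theorem MSet.pre_top {T : X → X} (hT : Measurable T) (k : ℕ) :
    (MSet.top : MSet X).pre hT k = MSet.top := rfl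

variable {μ : Measure X} [IsProbabilityMeasure μ]

/-- A finitely additive set function dominated by `μ` and invariant under an ergodic map is a
multiple of `μ`. -/
theorem additive_eq_of_ergodic {T : X → X} (hT : Measurable T) {k : ℕ} (hk : Ergodic T^[k] μ)
    (ρ : MSet X → ℝ) (h0 : ∀ A, 0 ≤ ρ A) (hle : ∀ A, ρ A ≤ μ.real A)
    (hadd : ∀ A D, ρ A = ρ (A ∩ D) + ρ (A ∩ Dᶜ)) (hinv : ∀ A, ρ (A.pre hT k) = ρ A) (A : MSet X) :
    ρ A = ρ MSet.top * μ.real A := by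
  have hempty : ρ ⟨∅, .empty⟩ = 0 := le_antisymm (by simpa using hle ⟨∅, .empty⟩) (h0 _)
  have hsum : ∀ (f : ℕ → Set X) (hf : ∀ i, MeasurableSet (f i)),
      Pairwise (Function.onFun Disjoint f) →
      HasSum (fun i => ρ ⟨f i, hf i⟩) (ρ ⟨⋃ i, f i, .iUnion hf⟩) := by
    intro f hf hd
    have hVm : ∀ n, MeasurableSet (⋃ i ≥ n, f i) := fun n =>
      .iUnion fun i => .iUnion fun _ => hf i
    have hpart : ∀ n, ρ ⟨⋃ i, f i, .iUnion hf⟩ =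
        ∑ i ∈ Finset.range n, ρ ⟨f i, hf i⟩ + ρ ⟨⋃ i ≥ n, f i, hVm n⟩ := by
      intro n
      induction n with
      | zero => simp
      | succ n ih =>
        rw [ih, Finset.sum_range_succ, add_assoc, hadd ⟨⋃ i ≥ n, f i, hVm n⟩ ⟨f n, hf n⟩]
        congr 3
        · refine Subtype.ext (inter_eq_right.2 ?_)
          exact subset_iUnion₂_of_subset n (le_refl n) subset_rfl
        · refine Subtype.ext (Set.ext fun x => ?_)
          simp only [MeasurableSet.coe_inter, MeasurableSet.coe_compl, mem_inter_iff, mem_iUnion,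
            exists_prop, mem_compl_iff]
          constructor
          · rintro ⟨⟨i, hi, hx⟩, hn⟩
            refine ⟨i, ?_, hx⟩
            rcases eq_or_lt_of_le hi with rfl | h
            · exact absurd hx hn
            · exact h
          · rintro ⟨i, hi, hx⟩
            refine ⟨⟨i, by omega, hx⟩, fun hn => ?_⟩
            exact disjoint_left.1 (hd (show i ≠ n by omega)) hx hn
    have hlim : Tendsto (fun n => ρ ⟨⋃ i ≥ n, f i, hVm n⟩) atTop (nhds 0) := by
      have h1 := tendsto_measure_biUnion_Ici_zero_of_pairwise_disjoint (μ := μ)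
        (fun i => (hf i).nullMeasurableSet) hd
      have h2 := (ENNReal.tendsto_toReal ENNReal.zero_ne_top).comp h1
      exact squeeze_zero (fun n => h0 _) (fun n => hle _) h2
    rw [hasSum_iff_tendsto_nat_of_nonneg (fun i => h0 _)]
    have : (fun n => ∑ i ∈ Finset.range n, ρ ⟨f i, hf i⟩) =
        fun n => ρ ⟨⋃ i, f i, .iUnion hf⟩ - ρ ⟨⋃ i ≥ n, f i, hVm n⟩ := by
      funext n; rw [hpart n]; ring
    rw [this]
    simpa using hlim.const_sub (ρ ⟨⋃ i, f i, .iUnion hf⟩)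
  let ν : Measure X := Measure.ofMeasurable (fun s hs => ENNReal.ofReal (ρ ⟨s, hs⟩))
    (by rw [hempty]; simp) (by
      intro f hf hd
      have h := hsum f hf hd
      rw [← h.tsum_eq, ENNReal.ofReal_tsum_of_nonneg (fun i => h0 _) h.summable])
  have hν : ∀ A : MSet X, ν A = ENNReal.ofReal (ρ A) := fun A =>
    Measure.ofMeasurable_apply _ A.2
  have hνμ : ν ≤ μ := Measure.le_iff.2 fun s hs => by
    have h1 := hν ⟨s, hs⟩
    simp only at h1
    rw [h1]
    exact (ENNReal.ofReal_le_ofReal (hle _)).trans ENNReal.ofReal_toReal_le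
  have hfin : IsFiniteMeasure ν := ⟨lt_of_le_of_lt (hνμ univ) (measure_lt_top μ univ)⟩
  have hpres : MeasurePreserving T^[k] ν ν := by
    refine ⟨hT.iterate k, Measure.ext fun s hs => ?_⟩
    rw [Measure.map_apply (hT.iterate k) hs]
    have h1 := hν (MSet.pre hT k ⟨s, hs⟩)
    have h2 := hν ⟨s, hs⟩
    rw [hinv] at h1
    exact h1.trans h2.symm
  obtain ⟨t, ht⟩ := hk.eq_smul_of_absolutelyContinuous hpres hνμ.absolutelyContinuous
  have hre : ∀ A : MSet X, ρ A = t.toReal * μ.real A := fun A => by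
    have := congrArg ENNReal.toReal (hν A)
    rw [ENNReal.toReal_ofReal (h0 A)] at this
    rw [← this, ht]
    simp [Measure.real]
  rw [hre A, hre MSet.top]
  simp [MSet.top]

/-- The product coupling, as a set function on rectangles. -/
noncomputable def prodCoupling (μ : Measure X) : MSet X → MSet X → ℝ :=
  fun A B => μ.real A * μ.real B

/-- Couplings of `(X, μ, T^M)` and `(X, μ, T^N)`, as set functions on rectangles. -/
structure IsCoupling (μ : Measure X) {T : X → X} (hT : Measurable T) (M N : ℕ)
    (c : MSet X → MSet X → ℝ) : Prop where
  nonneg : ∀ A B, 0 ≤ c A B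
  add_left : ∀ A D B, c A B = c (A ∩ D) B + c (A ∩ Dᶜ) B
  add_right : ∀ A B D, c A B = c A (B ∩ D) + c A (B ∩ Dᶜ)
  left : ∀ A, c A MSet.top = μ.real A
  right : ∀ B, c MSet.top B = μ.real B
  inv : ∀ A B, c (A.pre hT M) (B.pre hT N) = c A B

namespace IsCoupling

variable {T : X → X} {hT : Measurable T} {M N : ℕ} {c d : MSet X → MSet X → ℝ}

theorem mono (hc : IsCoupling μ hT M N c) {A A' B B' : MSet X} (hA : (A : Set X) ⊆ A')
    (hB : (B : Set X) ⊆ B') : c A B ≤ c A' B' := by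
  have hA' : A' ∩ A = A := Subtype.ext (inter_eq_right.2 hA)
  have hB' : B' ∩ B = B := Subtype.ext (inter_eq_right.2 hB)
  have h1 := hc.add_left A' A B
  have h2 := hc.add_right A' B' B
  rw [hA'] at h1
  rw [hB'] at h2
  have := hc.nonneg (A' ∩ Aᶜ) B
  have := hc.nonneg A' (B' ∩ Bᶜ)
  linarith

theorem le_left (hc : IsCoupling μ hT M N c) (A B : MSet X) : c A B ≤ μ.real A := by
  rw [← hc.left]
  exact hc.mono subset_rfl (subset_univ _)

theorem le_right (hc : IsCoupling μ hT M N c) (A B : MSet X) : c A B ≤ μ.real B := by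
  rw [← hc.right]
  exact hc.mono (subset_univ _) subset_rfl

theorem le_one (hc : IsCoupling μ hT M N c) (A B : MSet X) : c A B ≤ 1 :=
  (hc.le_left A B).trans measureReal_le_one

theorem top_top (hc : IsCoupling μ hT M N c) : c MSet.top MSet.top = 1 := by
  rw [hc.left]; simp [MSet.top]

/-- Changing both sides of a rectangle costs at most the measure of the change. -/
theorem le_add (hc : IsCoupling μ hT M N c) {A A' B B' U V : MSet X}
    (hA : (A : Set X) ⊆ A' ∪ U) (hB : (B : Set X) ⊆ B' ∪ V) :
    c A B ≤ c A' B' + μ.real U + μ.real V := by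
  have h1 : c A B ≤ c A' B + μ.real U := by
    rw [hc.add_left A A' B]
    refine add_le_add (hc.mono inter_subset_right subset_rfl) ((hc.mono ?_ subset_rfl).trans
      (hc.le_left U B))
    rintro x ⟨hx, hx'⟩
    exact (hA hx).resolve_left hx'
  have h2 : c A' B ≤ c A' B' + μ.real V := by
    rw [hc.add_right A' B B']
    refine add_le_add (hc.mono subset_rfl inter_subset_right) ((hc.mono subset_rfl ?_).trans
      (hc.le_right A' V))
    rintro x ⟨hx, hx'⟩
    exact (hB hx).resolve_left hx'
  linarith

theorem inv_iterate (hc : IsCoupling μ hT M N c) (k : ℕ) (A B : MSet X) :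
    c (A.pre hT (k * M)) (B.pre hT (k * N)) = c A B := by
  induction k with
  | zero => simp [MSet.pre]
  | succ k ih => rw [Nat.succ_mul, Nat.succ_mul, MSet.pre_add, MSet.pre_add, hc.inv, ih]

/-- A coupling is product if it is invariant under a second pair of powers. -/
theorem eq_prod (herg : ∀ k, 0 < k → Ergodic T^[k] μ) (hc : IsCoupling μ hT M N c) {a b : ℕ}
    (hab : a * N ≠ b * M) (hinv : ∀ A B, c (A.pre hT a) (B.pre hT b) = c A B) (A B : MSet X) :
    c A B = μ.real A * μ.real B := by
  have hiter : ∀ k A B, c (A.pre hT (k * a)) (B.pre hT (k * b)) = c A B := by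
    intro k A B
    induction k with
    | zero => simp [MSet.pre]
    | succ k ih => rw [Nat.succ_mul, Nat.succ_mul, MSet.pre_add, MSet.pre_add, hinv, ih]
  obtain ⟨K, hK, hKinv⟩ : ∃ K, 0 < K ∧ ∀ B, c A (B.pre hT K) = c A B := by
    rcases lt_or_gt_of_ne hab with h | h
    · refine ⟨b * M - a * N, by omega, fun B => ?_⟩
      rw [← hc.inv_iterate a, ← MSet.pre_add, show b * M - a * N + a * N = M * b by
        rw [mul_comm M b]; omega, mul_comm a M, hiter]
    · refine ⟨a * N - b * M, by omega, fun B => ?_⟩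
      rw [← hiter M, ← MSet.pre_add, show a * N - b * M + M * b = a * N by
        rw [mul_comm M b]; omega, mul_comm M a, hc.inv_iterate]
  rw [additive_eq_of_ergodic hT (herg K hK) (c A) (hc.nonneg A) (hc.le_right A) (hc.add_right A)
    hKinv B, hc.left]

/-- The part of a coupling that is left after removing a proportion of another one. -/
theorem sub_smul (hc : IsCoupling μ hT M N c) (hd : IsCoupling μ hT M N d) {p : ℝ} (hp : p < 1)
    (hle : ∀ A B, p * d A B ≤ c A B) :
    IsCoupling μ hT M N (fun A B => (1 - p)⁻¹ * (c A B - p * d A B)) := by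
  have h1 : 0 < 1 - p := by linarith
  refine ⟨fun A B => mul_nonneg (inv_nonneg.2 h1.le) (by linarith [hle A B]), fun A D B => ?_,
    fun A B D => ?_, fun A => ?_, fun B => ?_, fun A B => ?_⟩
  · rw [hc.add_left A D B, hd.add_left A D B]; ring
  · rw [hc.add_right A B D, hd.add_right A B D]; ring
  · rw [hc.left, hd.left]; field_simp
  · rw [hc.right, hd.right]; field_simp
  · rw [hc.inv, hd.inv]

/-- An extreme coupling is the only one of which it dominates a positive proportion. -/
theorem eq_of_extreme (hext : c ∈ extremePoints ℝ {c | IsCoupling μ hT M N c})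
    (hd : IsCoupling μ hT M N d) {p : ℝ} (hp : 0 < p) (hle : ∀ A B, p * d A B ≤ c A B) :
    d = c := by
  have hc : IsCoupling μ hT M N c := hext.1
  have hp1 : p ≤ 1 := by
    have := hle MSet.top MSet.top
    rw [hc.top_top, hd.top_top] at this
    linarith
  rcases eq_or_lt_of_le hp1 with rfl | hp1
  · funext A B
    simp only [one_mul] at hle
    refine le_antisymm (hle A B) ?_
    have h1 := hc.add_left MSet.top A MSet.top
    have h2 := hd.add_left MSet.top A MSet.top
    have h3 := hc.add_right A MSet.top B
    have h4 := hd.add_right A MSet.top B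
    rw [MSet.top_inter, MSet.top_inter] at h1 h2 h3 h4
    rw [hc.top_top] at h1
    rw [hd.top_top] at h2
    have := hle Aᶜ MSet.top
    have := hle A Bᶜ
    linarith
  · refine (mem_extremePoints.1 hext).2 d hd _ (hc.sub_smul hd hp1 hle) ?_ |>.1
    refine ⟨p, 1 - p, hp, by linarith, by ring, ?_⟩
    funext A B
    have h1 : 1 - p ≠ 0 := by linarith
    simp only [Pi.add_apply, Pi.smul_apply, smul_eq_mul]
    field_simp
    ring

end IsCoupling

theorem isClosed_isCoupling {T : X → X} (hT : Measurable T) (M N : ℕ) :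
    IsClosed {c : MSet X → MSet X → ℝ | IsCoupling μ hT M N c} := by
  have : {c : MSet X → MSet X → ℝ | IsCoupling μ hT M N c} =
      {c | ∀ A B, 0 ≤ c A B} ∩ {c | ∀ A D B, c A B = c (A ∩ D) B + c (A ∩ Dᶜ) B} ∩
      {c | ∀ A B D, c A B = c A (B ∩ D) + c A (B ∩ Dᶜ)} ∩ {c | ∀ A : MSet X, c A MSet.top = μ.real A} ∩
      {c | ∀ B : MSet X, c MSet.top B = μ.real B} ∩
      {c | ∀ A B, c (A.pre hT M) (B.pre hT N) = c A B} := by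
    ext c
    constructor
    · rintro ⟨h1, h2, h3, h4, h5, h6⟩
      exact ⟨⟨⟨⟨⟨h1, h2⟩, h3⟩, h4⟩, h5⟩, h6⟩
    · rintro ⟨⟨⟨⟨⟨h1, h2⟩, h3⟩, h4⟩, h5⟩, h6⟩
      exact ⟨h1, h2, h3, h4, h5, h6⟩
  rw [this]
  simp only [ofPred_forall]
  have hev : ∀ A B : MSet X, Continuous fun c : MSet X → MSet X → ℝ => c A B := fun A B =>
    (continuous_apply B).comp (continuous_apply A)
  refine ((((IsClosed.inter ?_ ?_).inter ?_).inter ?_).inter ?_).inter ?_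
  · exact isClosed_iInter fun A => isClosed_iInter fun B => isClosed_le continuous_const (hev A B)
  · exact isClosed_iInter fun A => isClosed_iInter fun D => isClosed_iInter fun B =>
      isClosed_eq (hev _ _) ((hev _ _).add (hev _ _))
  · exact isClosed_iInter fun A => isClosed_iInter fun D => isClosed_iInter fun B =>
      isClosed_eq (hev _ _) ((hev _ _).add (hev _ _))
  · exact isClosed_iInter fun A => isClosed_eq (hev _ _) continuous_const
  · exact isClosed_iInter fun A => isClosed_eq (hev _ _) continuous_const
  · exact isClosed_iInter fun A => isClosed_iInter fun B => isClosed_eq (hev _ _) (hev _ _)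

theorem isCompact_isCoupling {T : X → X} (hT : Measurable T) (M N : ℕ) :
    IsCompact {c : MSet X → MSet X → ℝ | IsCoupling μ hT M N c} := by
  have hK : IsCompact (Set.pi univ fun _ : MSet X => Set.pi univ fun _ : MSet X => Icc (0 : ℝ) 1) :=
    isCompact_univ_pi fun _ => isCompact_univ_pi fun _ => isCompact_Icc
  refine hK.of_isClosed_subset (isClosed_isCoupling hT M N) fun c hc => ?_
  simp only [Set.mem_pi, mem_univ, true_implies]
  exact fun A B => ⟨hc.nonneg A B, hc.le_one A B⟩

theorem convex_isCoupling {T : X → X} (hT : Measurable T) (M N : ℕ) :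
    Convex ℝ {c : MSet X → MSet X → ℝ | IsCoupling μ hT M N c} := by
  intro c hc d hd a b ha hb hab
  refine ⟨fun A B => ?_, fun A D B => ?_, fun A B D => ?_, fun A => ?_, fun B => ?_, fun A B => ?_⟩
    <;> simp only [Pi.add_apply, Pi.smul_apply, smul_eq_mul]
  · exact add_nonneg (mul_nonneg ha (hc.nonneg A B)) (mul_nonneg hb (hd.nonneg A B))
  · rw [hc.add_left A D B, hd.add_left A D B]; ring
  · rw [hc.add_right A B D, hd.add_right A B D]; ring
  · rw [hc.left, hd.left, ← add_mul, hab, one_mul]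
  · rw [hc.right, hd.right, ← add_mul, hab, one_mul]
  · rw [hc.inv, hd.inv]

/-- If some coupling is not the product, then some extreme coupling is not the product. -/
theorem exists_extreme_ne_prod {T : X → X} (hT : Measurable T) {M N : ℕ}
    {c : MSet X → MSet X → ℝ} (hc : IsCoupling μ hT M N c)
    (hne : c ≠ prodCoupling μ) :
    ∃ d ∈ extremePoints ℝ {c | IsCoupling μ hT M N c}, d ≠ prodCoupling μ := by
  by_contra! h
  have hKM := closure_convexHull_extremePoints (isCompact_isCoupling (μ := μ) hT M N)
    (convex_isCoupling hT M N)
  have hsub : extremePoints ℝ {c | IsCoupling μ hT M N c} ⊆ {prodCoupling μ} :=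
    fun d hd => h d hd
  have h1 : c ∈ closure (convexHull ℝ (extremePoints ℝ {c | IsCoupling μ hT M N c})) := by
    rw [hKM]; exact hc
  have h2 := closure_mono (convexHull_mono hsub) h1
  rw [convexHull_singleton, closure_singleton] at h2
  exact hne h2

/-- The coupling given by a joining. -/
theorem IsJoining.isCoupling {T : X → X} (hT : Measurable T) {M N : ℕ} {σ : Measure (X × X)}
    (hσ : IsJoining μ μ T^[M] T^[N] σ) :
    IsCoupling μ hT M N (fun A B => σ.real ((A : Set X) ×ˢ (B : Set X))) := by
  have : IsFiniteMeasure σ := by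
    refine ⟨?_⟩
    have h := congrArg (fun ν : Measure X => ν univ) hσ.map_fst
    simp only [Measure.map_apply measurable_fst .univ, preimage_univ, measure_univ] at h
    rw [h]; exact ENNReal.one_lt_top
  refine ⟨fun A B => measureReal_nonneg, fun A D B => ?_, fun A B D => ?_, fun A => ?_, fun B => ?_,
    fun A B => ?_⟩
  · rw [← measureReal_inter_add_sdiff (s := (A : Set X) ×ˢ (B : Set X))
      (D.2.prod MeasurableSet.univ)]
    congr 2 <;> ext x <;> simp <;> tauto
  · rw [← measureReal_inter_add_sdiff (s := (A : Set X) ×ˢ (B : Set X))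
      (MeasurableSet.univ.prod D.2)]
    congr 2 <;> ext x <;> simp <;> tauto
  · rw [← hσ.map_fst, map_measureReal_apply measurable_fst A.2]
    congr 1; ext x; simp [MSet.top]
  · rw [← hσ.map_snd, map_measureReal_apply measurable_snd B.2]
    congr 1; ext x; simp [MSet.top]
  · exact hσ.invariant.measureReal_preimage (A.2.prod B.2).nullMeasurableSet

/-- If all extreme couplings are the product, the systems are disjoint. -/
theorem disjointSystems_of_extreme {T : X → X} (hT : Measurable T) {M N : ℕ}
    (h : ∀ d ∈ extremePoints ℝ {c | IsCoupling μ hT M N c}, d = prodCoupling μ) :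
    DisjointSystems μ μ T^[M] T^[N] := by
  intro σ hσ
  have hc := hσ.isCoupling hT
  have heq : (fun A B : MSet X => σ.real ((A : Set X) ×ˢ (B : Set X))) =
      prodCoupling μ := by
    by_contra hne
    obtain ⟨d, hd, hd'⟩ := exists_extreme_ne_prod hT hc hne
    exact hd' (h d hd)
  have : IsFiniteMeasure σ := by
    refine ⟨?_⟩
    have h := congrArg (fun ν : Measure X => ν univ) hσ.map_fst
    simp only [Measure.map_apply measurable_fst .univ, preimage_univ, measure_univ] at h
    rw [h]; exact ENNReal.one_lt_top
  refine (Measure.prod_eq fun s t hs ht => ?_).symm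
  have := congrFun (congrFun heq ⟨s, hs⟩) ⟨t, ht⟩
  simp only [Measure.real, prodCoupling] at this
  rw [← ENNReal.toReal_mul] at this
  exact (ENNReal.toReal_eq_toReal_iff' (measure_ne_top _ _)
    (ENNReal.mul_ne_top (measure_ne_top _ _) (measure_ne_top _ _))).1 this

end Couplings

section AsymptoticReturns

set_option linter.unusedSectionVars false

variable {X ι : Type*} [MeasurableSpace X] {μ : Measure X} [IsProbabilityMeasure μ] {T : X → X}

/-- Along the filter `l`, the iterate `T^[R i]` is close in measure to `x ↦ T^[e i x] x`, where the
function `e i` is almost invariant. -/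
structure AsymptoticReturn (l : Filter ι) (μ : Measure X) (T : X → X) (R : ι → ℕ)
    (e : ι → X → ℕ) : Prop where
  meas : ∀ i, Measurable (e i)
  ret : ∀ A, MeasurableSet A →
    Tendsto (fun i => μ.real {x | ¬ (T^[R i] x ∈ A ↔ T^[e i x] x ∈ A)}) l (nhds 0)
  inv : Tendsto (fun i => μ.real {x | e i (T x) ≠ e i x}) l (nhds 0)

/-- The level set of a measurable function. -/
def MSet.level {f : X → ℕ} (hf : Measurable f) (a : ℕ) : MSet X :=
  ⟨f ⁻¹' {a}, hf (MeasurableSet.singleton a)⟩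

theorem Ultrafilter.exists_tendsto_of_mem_Icc (𝒰 : Ultrafilter ι) {u : ι → ℝ}
    (h : ∀ i, u i ∈ Icc (0 : ℝ) 1) : ∃ x ∈ Icc (0 : ℝ) 1, Tendsto u 𝒰 (nhds x) := by
  obtain ⟨x, hx, hle⟩ := (isCompact_Icc (a := (0 : ℝ)) (b := 1)).ultrafilter_le_nhds (𝒰.map u)
    (le_principal_iff.2 (mem_map.2 (univ_mem' h)))
  exact ⟨x, hx, hle⟩

theorem AsymptoticReturn.inv_iterate {l : Filter ι} {R : ι → ℕ} {e : ι → X → ℕ}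
    (he : AsymptoticReturn l μ T R e) (hT : MeasurePreserving T μ μ) (k : ℕ) :
    Tendsto (fun i => μ.real {x | e i (T^[k] x) ≠ e i x}) l (nhds 0) := by
  induction k with
  | zero => simpa using tendsto_const_nhds
  | succ k ih =>
    have h := he.inv.add ih
    rw [add_zero] at h
    refine squeeze_zero (fun i => measureReal_nonneg) (fun i => ?_) h
    have hm : MeasurableSet {x | e i (T x) ≠ e i x} :=
      (measurableSet_eq_fun ((he.meas i).comp hT.measurable) (he.meas i)).compl
    have hpre := (hT.iterate k).measureReal_preimage hm.nullMeasurableSet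
    rw [← hpre]
    refine (measureReal_mono ?_).trans (measureReal_union_le _ _)
    intro x hx
    by_contra hcon
    simp only [mem_union, mem_preimage, mem_ofPred_eq, not_or, not_not] at hcon
    apply hx
    rw [Function.iterate_succ_apply', hcon.1, hcon.2]

theorem IsCoupling.tendsto_level_of_extreme {𝒰 : Ultrafilter ι} (hT : MeasurePreserving T μ μ)
    (herg : ∀ k, 0 < k → Ergodic T^[k] μ) {M N : ℕ} (hM : 0 < M) (hN : 0 < N)
    {c : MSet X → MSet X → ℝ}
    (hext : c ∈ extremePoints ℝ {c | IsCoupling μ hT.measurable M N c})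
    {R R' : ι → ℕ} {e f : ι → X → ℕ}
    (he : AsymptoticReturn 𝒰 μ T R e) (hf : AsymptoticReturn 𝒰 μ T R' f) (a b : ℕ) :
    ∃ p : ℝ, 0 ≤ p ∧ ∀ A B, Tendsto (fun i => c (A ∩ MSet.level (he.meas i) a)
      (B ∩ MSet.level (hf.meas i) b)) 𝒰 (nhds (p * c A B)) := by
  have hc : IsCoupling μ hT.measurable M N c := hext.1
  choose d hd hlim using fun A B => 𝒰.exists_tendsto_of_mem_Icc
    (u := fun i => c (A ∩ MSet.level (he.meas i) a) (B ∩ MSet.level (hf.meas i) b))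
    fun i => ⟨hc.nonneg _ _, hc.le_one _ _⟩
  have hdc : ∀ A B, d A B ≤ c A B := fun A B =>
    le_of_tendsto (hlim A B) (Eventually.of_forall fun i =>
      hc.mono inter_subset_left inter_subset_left)
  have hadd_left : ∀ A D B, d A B = d (A ∩ D) B + d (A ∩ Dᶜ) B := by
    intro A D B
    refine tendsto_nhds_unique (hlim A B) (((hlim (A ∩ D) B).add (hlim (A ∩ Dᶜ) B)).congr fun i => ?_)
    rw [hc.add_left (A ∩ MSet.level (he.meas i) a) D]
    congr 2 <;> exact Subtype.ext (inter_right_comm _ _ _)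
  have hadd_right : ∀ A B D, d A B = d A (B ∩ D) + d A (B ∩ Dᶜ) := by
    intro A B D
    refine tendsto_nhds_unique (hlim A B) (((hlim A (B ∩ D)).add (hlim A (B ∩ Dᶜ))).congr fun i => ?_)
    rw [hc.add_right _ (B ∩ MSet.level (hf.meas i) b) D]
    congr 2 <;> exact Subtype.ext (inter_right_comm _ _ _)
  have hinv : ∀ A B, d (A.pre hT.measurable M) (B.pre hT.measurable N) = d A B := by
    intro A B
    let U : ι → MSet X := fun i => ⟨{x | e i (T^[M] x) ≠ e i x},
      (measurableSet_eq_fun ((he.meas i).comp (hT.measurable.iterate M)) (he.meas i)).compl⟩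
    let V : ι → MSet X := fun i => ⟨{x | f i (T^[N] x) ≠ f i x},
      (measurableSet_eq_fun ((hf.meas i).comp (hT.measurable.iterate N)) (hf.meas i)).compl⟩
    have hUV : Tendsto (fun i => μ.real (U i) + μ.real (V i)) 𝒰 (nhds 0) := by
      simpa using (he.inv_iterate hT M).add (hf.inv_iterate hT N)
    have hpre : ∀ i, c ((A ∩ MSet.level (he.meas i) a).pre hT.measurable M)
        ((B ∩ MSet.level (hf.meas i) b).pre hT.measurable N) =
        c (A ∩ MSet.level (he.meas i) a) (B ∩ MSet.level (hf.meas i) b) := fun i => hc.inv _ _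
    refine le_antisymm ?_ ?_
    · have h2 := (hlim A B).add hUV
      rw [add_zero] at h2
      refine le_of_tendsto_of_tendsto' (hlim _ _) h2 fun i => ?_
      rw [← hpre i, ← add_assoc]
      refine hc.le_add (fun x hx => ?_) (fun x hx => ?_)
      · by_cases h : e i (T^[M] x) = e i x
        · exact Or.inl ⟨hx.1, h.trans hx.2⟩
        · exact Or.inr h
      · by_cases h : f i (T^[N] x) = f i x
        · exact Or.inl ⟨hx.1, h.trans hx.2⟩
        · exact Or.inr h
    · have h2 := (hlim (A.pre hT.measurable M) (B.pre hT.measurable N)).add hUV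
      rw [add_zero] at h2
      refine le_of_tendsto_of_tendsto' (hlim _ _) h2 fun i => ?_
      rw [← hpre i, ← add_assoc]
      refine hc.le_add (fun x hx => ?_) (fun x hx => ?_)
      · by_cases h : e i (T^[M] x) = e i x
        · exact Or.inl ⟨hx.1, h.symm.trans hx.2⟩
        · exact Or.inr h
      · by_cases h : f i (T^[N] x) = f i x
        · exact Or.inl ⟨hx.1, h.symm.trans hx.2⟩
        · exact Or.inr h
  have hnonneg : ∀ A B, 0 ≤ d A B := fun A B => (hd A B).1
  have hleft : ∀ A, d A MSet.top = d MSet.top MSet.top * μ.real A := fun A =>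
    additive_eq_of_ergodic hT.measurable (herg M hM) (fun A => d A MSet.top)
      (fun A => hnonneg _ _) (fun A => (hdc _ _).trans (hc.le_left _ _))
      (fun A D => hadd_left A D _) (fun A => hinv A MSet.top) A
  have hright : ∀ B, d MSet.top B = d MSet.top MSet.top * μ.real B := fun B =>
    additive_eq_of_ergodic hT.measurable (herg N hN) (fun B => d MSet.top B)
      (fun B => hnonneg _ _) (fun B => (hdc _ _).trans (hc.le_right _ _))
      (fun B D => hadd_right _ B D) (fun B => hinv MSet.top B) B
  refine ⟨d MSet.top MSet.top, hnonneg _ _, fun A B => ?_⟩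
  suffices h : d A B = d MSet.top MSet.top * c A B by rw [← h]; exact hlim A B
  rcases (hnonneg MSet.top MSet.top).eq_or_lt with h0 | hpos
  · have h1 : d A B ≤ d A MSet.top := by
      have h := hadd_right A MSet.top B
      rw [MSet.top_inter, MSet.top_inter] at h
      linarith [hnonneg A Bᶜ]
    rw [hleft, ← h0, zero_mul] at h1
    rw [← h0, zero_mul]
    exact le_antisymm h1 (hnonneg _ _)
  · set p := d MSet.top MSet.top with hp
    have hK : IsCoupling μ hT.measurable M N (fun A B => p⁻¹ * d A B) := by
      refine ⟨fun A B => mul_nonneg (inv_nonneg.2 hpos.le) (hnonneg _ _), fun A D B => ?_,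
        fun A B D => ?_, fun A => ?_, fun B => ?_, fun A B => ?_⟩
      · rw [hadd_left A D B, mul_add]
      · rw [hadd_right A B D, mul_add]
      · rw [hleft, inv_mul_cancel_left₀ hpos.ne']
      · rw [hright, inv_mul_cancel_left₀ hpos.ne']
      · rw [hinv]
    have h := IsCoupling.eq_of_extreme hext hK hpos (fun A B => by
      rw [mul_inv_cancel_left₀ hpos.ne']; exact hdc A B)
    rw [← h, mul_inv_cancel_left₀ hpos.ne']

theorem IsCoupling.comp_pre {M N : ℕ} {c : MSet X → MSet X → ℝ} (hT : MeasurePreserving T μ μ)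
    (hc : IsCoupling μ hT.measurable M N c) (a b : ℕ) :
    IsCoupling μ hT.measurable M N
      (fun A B => c (A.pre hT.measurable a) (B.pre hT.measurable b)) := by
  refine ⟨fun A B => hc.nonneg _ _, fun A D B => hc.add_left _ (D.pre hT.measurable a) _,
    fun A B D => hc.add_right _ _ (D.pre hT.measurable b), fun A => ?_, fun B => ?_, fun A B => ?_⟩
  · rw [MSet.pre_top, hc.left]
    exact (hT.iterate a).measureReal_preimage A.2.nullMeasurableSet
  · rw [MSet.pre_top, hc.right]
    exact (hT.iterate b).measureReal_preimage B.2.nullMeasurableSet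
  · rw [← MSet.pre_add, ← MSet.pre_add, add_comm M, add_comm N, MSet.pre_add, MSet.pre_add, hc.inv]

/-- For an extreme coupling that is not the product, the return labels are asymptotically
proportional to the powers. -/
theorem IsCoupling.tendsto_level_zero {𝒰 : Ultrafilter ι} (hT : MeasurePreserving T μ μ)
    (herg : ∀ k, 0 < k → Ergodic T^[k] μ) {M N : ℕ} (hM : 0 < M) (hN : 0 < N)
    {c : MSet X → MSet X → ℝ}
    (hext : c ∈ extremePoints ℝ {c | IsCoupling μ hT.measurable M N c}) (hne : c ≠ prodCoupling μ)
    {r : ι → ℕ} {e f : ι → X → ℕ}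
    (he : AsymptoticReturn 𝒰 μ T (fun i => r i * M) e)
    (hf : AsymptoticReturn 𝒰 μ T (fun i => r i * N) f) {a b : ℕ} (hab : a * N ≠ b * M) :
    Tendsto (fun i => c (MSet.level (he.meas i) a) (MSet.level (hf.meas i) b)) 𝒰 (nhds 0) := by
  have hc : IsCoupling μ hT.measurable M N c := hext.1
  obtain ⟨p, hp, hlim⟩ := IsCoupling.tendsto_level_of_extreme hT herg hM hN hext he hf a b
  rcases hp.eq_or_lt with rfl | hpos
  · simpa [MSet.top_inter] using hlim MSet.top MSet.top
  · exfalso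
    refine hne (funext fun A => funext fun B => hc.eq_prod herg hab (fun A B => ?_) A B)
    refine congrFun (congrFun (IsCoupling.eq_of_extreme hext (hc.comp_pre hT a b) hpos
      fun A B => ?_) A) B
    have hU := fun (A : MSet X) => he.ret A A.2
    have hV := fun (A : MSet X) => hf.ret A A.2
    let U : ι → MSet X := fun i => ⟨{x | e i x = a ∧ ¬ (T^[r i * M] x ∈ (A : Set X) ↔ T^[a] x ∈ (A : Set X))}, by
      have h1 := (A.pre hT.measurable (r i * M)).2
      have h2 := (A.pre hT.measurable a).2
      have h3 := (MSet.level (he.meas i) a).2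
      exact h3.inter (h1.iff h2).compl⟩
    let V : ι → MSet X := fun i => ⟨{x | f i x = b ∧ ¬ (T^[r i * N] x ∈ (B : Set X) ↔ T^[b] x ∈ (B : Set X))}, by
      have h1 := (B.pre hT.measurable (r i * N)).2
      have h2 := (B.pre hT.measurable b).2
      have h3 := (MSet.level (hf.meas i) b).2
      exact h3.inter (h1.iff h2).compl⟩
    have hUV : Tendsto (fun i => μ.real (U i) + μ.real (V i)) 𝒰 (nhds 0) := by
      have h := (hU A).add (hV B)
      rw [add_zero] at h
      refine squeeze_zero (fun i => add_nonneg measureReal_nonneg measureReal_nonneg) (fun i => ?_) h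
      refine add_le_add (measureReal_mono ?_) (measureReal_mono ?_)
      · rintro x ⟨h1, h2⟩
        simp only [mem_ofPred_eq]
        rwa [h1]
      · rintro x ⟨h1, h2⟩
        simp only [mem_ofPred_eq]
        rwa [h1]
    have hlim2 := hUV.const_add (c A B)
    rw [add_zero] at hlim2
    refine le_of_tendsto_of_tendsto' (hlim (A.pre hT.measurable a) (B.pre hT.measurable b)) hlim2
      fun i => ?_
    rw [← hc.inv_iterate (r i) A B, ← add_assoc]
    refine hc.le_add ?_ ?_
    · rintro x ⟨h1, h2⟩
      by_cases h : T^[r i * M] x ∈ (A : Set X)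
      · exact Or.inl h
      · exact Or.inr ⟨h2, fun hiff => h (hiff.2 h1)⟩
    · rintro x ⟨h1, h2⟩
      by_cases h : T^[r i * N] x ∈ (B : Set X)
      · exact Or.inl h
      · exact Or.inr ⟨h2, fun hiff => h (hiff.2 h1)⟩

theorem IsCoupling.sum_level {M N : ℕ} {hT : Measurable T} {c : MSet X → MSet X → ℝ}
    (hc : IsCoupling μ hT M N c) {f : X → ℕ} (hf : Measurable f) {E : ℕ} (hE : ∀ x, f x ≤ E)
    (A B : MSet X) :
    c A B = ∑ b ∈ Finset.range (E + 1), c A (B ∩ MSet.level hf b) := by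
  have key : ∀ k, c A B = ∑ b ∈ Finset.range k, c A (B ∩ MSet.level hf b) +
      c A (B ∩ ⟨{x | k ≤ f x}, measurableSet_le measurable_const hf⟩) := by
    intro k
    induction k with
    | zero =>
      simp only [Finset.range_zero, Finset.sum_empty, zero_add, zero_le]
      congr 1
      exact Subtype.ext (by simp)
    | succ k ih =>
      rw [ih, Finset.sum_range_succ, add_assoc]
      rw [hc.add_right A (B ∩ ⟨{x | k ≤ f x}, measurableSet_le measurable_const hf⟩)
        (MSet.level hf k)]
      congr 3 <;> refine Subtype.ext (Set.ext fun x => ?_)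
      · simp only [MSet.level, MeasurableSet.coe_inter, mem_inter_iff, mem_ofPred_eq, mem_preimage,
          mem_singleton_iff]
        constructor
        · rintro ⟨⟨h1, h2⟩, h3⟩; exact ⟨h1, h3⟩
        · rintro ⟨h1, h3⟩; exact ⟨⟨h1, h3.ge⟩, h3⟩
      · simp only [MSet.level, MeasurableSet.coe_inter, MeasurableSet.coe_compl, mem_inter_iff,
          mem_ofPred_eq, mem_compl_iff, mem_preimage, mem_singleton_iff]
        constructor
        · rintro ⟨⟨h1, h2⟩, h3⟩; exact ⟨h1, by omega⟩
        · rintro ⟨h1, h3⟩; exact ⟨⟨h1, by omega⟩, by omega⟩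
  rw [key (E + 1)]
  have h0 : c A (B ∩ ⟨{x | E + 1 ≤ f x}, measurableSet_le measurable_const hf⟩) = 0 := by
    refine le_antisymm ((hc.le_right _ _).trans ?_) (hc.nonneg _ _)
    have : ((B ∩ ⟨{x | E + 1 ≤ f x}, measurableSet_le measurable_const hf⟩ : MSet X) : Set X) = ∅ := by
      ext x
      simp only [MeasurableSet.coe_inter, mem_inter_iff, mem_ofPred_eq, mem_empty_iff_false,
        iff_false, not_and, not_le]
      exact fun _ => Nat.lt_succ_of_le (hE x)
    rw [this]; simp
  rw [h0, add_zero]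

end AsymptoticReturns

section Windows

set_option linter.unusedSectionVars false

variable {X ι : Type*} [MeasurableSpace X] {μ : Measure X} [IsProbabilityMeasure μ] {T : X → X}

theorem IsCoupling.swap {M N : ℕ} {hT : Measurable T} {c : MSet X → MSet X → ℝ}
    (hc : IsCoupling μ hT M N c) : IsCoupling μ hT N M (fun A B => c B A) :=
  ⟨fun _ _ => hc.nonneg _ _, fun _ _ _ => hc.add_right _ _ _, fun _ _ _ => hc.add_left _ _ _,
    hc.right, hc.left, fun _ _ => hc.inv _ _⟩

/-- If the labels are asymptotically proportional to the coprime pair `(m, n)` and the second label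
changes by less than `n` in a window, then neither label changes in the window. -/
theorem IsCoupling.tendsto_window_zero {𝒰 : Filter ι} {M N m n d : ℕ} {hT : Measurable T}
    (hM : M = m * d) (hN : N = n * d) (hd : 0 < d) (hn : 0 < n) (hcop : Nat.Coprime m n)
    {c : MSet X → MSet X → ℝ} (hc : IsCoupling μ hT M N c) {e f : ι → X → ℕ}
    (he : ∀ i, Measurable (e i)) (hf : ∀ i, Measurable (f i)) {E : ℕ} (hE : ∀ i x, e i x ≤ E)
    (hF : ∀ i x, f i x ≤ E)
    (hlim : ∀ a b, a * N ≠ b * M →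
      Tendsto (fun i => c (MSet.level (he i) a) (MSet.level (hf i) b)) 𝒰 (nhds 0))
    (w : ι → ℕ)
    (hsmall : ∀ᶠ i in 𝒰, ∀ᵐ x ∂μ, |(f i (T^[w i * N] x) : ℤ) - f i x| < n)
    (D V : ι → MSet X) (hDV : ∀ i, ∀ x ∈ (D i : Set X), ∀ y ∈ (V i : Set X),
      e i (T^[w i * M] x) = e i x → f i (T^[w i * N] y) ≠ f i y) :
    Tendsto (fun i => c (D i) (V i)) 𝒰 (nhds 0) := by
  let A : ι → ℕ → MSet X := fun i a => MSet.level (he i) a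
  let A' : ι → ℕ → MSet X := fun i a => MSet.level ((he i).comp (hT.iterate (w i * M))) a
  let B : ι → ℕ → MSet X := fun i a => MSet.level (hf i) a
  let B' : ι → ℕ → MSet X := fun i a => MSet.level ((hf i).comp (hT.iterate (w i * N))) a
  have hrect : ∀ a a' b b', Tendsto
      (fun i => c (D i ∩ A i a ∩ A' i a') (V i ∩ B i b ∩ B' i b')) 𝒰 (nhds 0) := by
    intro a a' b b'
    by_cases h1 : a * N = b * M
    swap
    · exact squeeze_zero (fun i => hc.nonneg _ _) (fun i => hc.mono
        (fun x hx => hx.1.2) (fun x hx => hx.1.2)) (hlim a b h1)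
    by_cases h2 : a' * N = b' * M
    swap
    · refine squeeze_zero (fun i => hc.nonneg _ _) (fun i => ?_) (hlim a' b' h2)
      refine le_trans ?_ (hc.inv_iterate (w i) _ _).le
      exact hc.mono (fun x hx => hx.2) (fun x hx => hx.2)
    by_cases hb : b = b'
    · subst hb
      have ha : a = a' := by
        refine Nat.eq_of_mul_eq_mul_right (show 0 < N by rw [hN]; positivity) (h1.trans h2.symm)
      subst ha
      refine (tendsto_const_nhds (x := (0 : ℝ))).congr fun i => ?_
      rcases eq_empty_or_nonempty ((V i ∩ B i b ∩ B' i b : MSet X) : Set X) with hV | ⟨y, hy⟩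
      · refine (le_antisymm ((hc.le_right _ _).trans ?_) (hc.nonneg _ _)).symm
        rw [hV]; simp
      · rcases eq_empty_or_nonempty ((D i ∩ A i a ∩ A' i a : MSet X) : Set X) with hD | ⟨x, hx⟩
        · refine (le_antisymm ((hc.le_left _ _).trans ?_) (hc.nonneg _ _)).symm
          rw [hD]; simp
        · exact absurd (Eq.trans hy.2 hy.1.2.symm)
            (hDV i x hx.1.1 y hy.1.1 (Eq.trans hx.2 hx.1.2.symm))
    · have hdvd : (n : ℤ) ∣ (b' : ℤ) - b := by
        have h3 : ((b' : ℤ) - b) * m = (a' - a) * n := by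
          have e1 : (a : ℤ) * n = b * m := by
            rw [hM, hN, ← mul_assoc, ← mul_assoc] at h1
            exact_mod_cast Nat.eq_of_mul_eq_mul_right hd h1
          have e2 : (a' : ℤ) * n = b' * m := by
            rw [hM, hN, ← mul_assoc, ← mul_assoc] at h2
            exact_mod_cast Nat.eq_of_mul_eq_mul_right hd h2
          linear_combination e1 - e2
        refine IsCoprime.dvd_of_dvd_mul_right (Nat.isCoprime_iff_coprime.2 hcop).symm ⟨a' - a, ?_⟩
        rw [h3, mul_comm]
      have hle : (n : ℤ) ≤ |(b' : ℤ) - b| := by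
        have := Int.le_of_dvd (abs_pos.2 (sub_ne_zero.2 (by exact_mod_cast (Ne.symm hb))))
          ((dvd_abs _ _).2 hdvd)
        exact this
      refine tendsto_const_nhds.congr' ?_
      filter_upwards [hsmall] with i hi
      refine (le_antisymm ((hc.le_right _ _).trans ?_) (hc.nonneg _ _)).symm
      have h0 : μ ((V i ∩ B i b ∩ B' i b' : MSet X) : Set X) = 0 := by
        refine measure_mono_null (fun y hy => ?_) (ae_iff.1 hi)
        have hy1 : f i y = b := hy.1.2
        have hy2 : f i (T^[w i * N] y) = b' := hy.2
        simp only [mem_ofPred_eq, hy1, hy2, not_lt]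
        exact hle
      rw [Measure.real, h0, ENNReal.toReal_zero]
  have hsum : ∀ i, c (D i) (V i) = ∑ a ∈ Finset.range (E + 1), ∑ a' ∈ Finset.range (E + 1),
      ∑ b ∈ Finset.range (E + 1), ∑ b' ∈ Finset.range (E + 1),
        c (D i ∩ A i a ∩ A' i a') (V i ∩ B i b ∩ B' i b') := by
    intro i
    rw [hc.swap.sum_level (he i) (hE i) (V i) (D i)]
    refine Finset.sum_congr rfl fun a _ => ?_
    rw [hc.swap.sum_level ((he i).comp (hT.iterate (w i * M))) (fun x => hE i _) (V i) _]
    refine Finset.sum_congr rfl fun a' _ => ?_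
    rw [hc.sum_level (hf i) (hF i) _ (V i)]
    refine Finset.sum_congr rfl fun b _ => ?_
    rw [hc.sum_level ((hf i).comp (hT.iterate (w i * N))) (fun x => hF i _) _ _]
  simp only [hsum]
  have : (0 : ℝ) = ∑ a ∈ Finset.range (E + 1), ∑ a' ∈ Finset.range (E + 1),
      ∑ b ∈ Finset.range (E + 1), ∑ b' ∈ Finset.range (E + 1), (0 : ℝ) := by simp
  rw [this]
  exact tendsto_finsetSum _ fun a _ => tendsto_finsetSum _ fun a' _ =>
    tendsto_finsetSum _ fun b _ => tendsto_finsetSum _ fun b' _ => hrect a a' b b'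

/-- An ergodic map is totally ergodic if along returns its labels take two neighbouring values with
probabilities bounded from below. -/
theorem ergodic_iterate_of_return {𝒰 : Ultrafilter ι} (hT : Ergodic T μ) {N : ℕ} {r : ι → ℕ}
    {e : ι → X → ℕ} (he : AsymptoticReturn 𝒰 μ T (fun i => r i * N) e) {E : ℕ}
    (hE : ∀ i x, e i x ≤ E) (w : ι → ℕ) {η : ℝ} (hη : 0 < η)
    (hjump : ∀ᶠ i in 𝒰, η ≤ μ.real {x | e i (T^[w i] x) = e i x + 1 ∨ e i x = e i (T^[w i] x) + 1}) :
    Ergodic T^[N] μ := by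
  have hmp := hT.toMeasurePreserving
  have herg1 : Ergodic T^[1] μ := by simpa using hT
  -- asymptotic density of the level sets
  have hdens : ∀ a, ∃ p : ℝ, ∀ B : MSet X,
      Tendsto (fun i => μ.real ((B ∩ MSet.level (he.meas i) a : MSet X) : Set X)) 𝒰
        (nhds (p * μ.real B)) := by
    intro a
    choose ρ hρ hlim using fun B : MSet X => 𝒰.exists_tendsto_of_mem_Icc
      (u := fun i => μ.real ((B ∩ MSet.level (he.meas i) a : MSet X) : Set X))
      fun i => ⟨measureReal_nonneg, measureReal_le_one⟩
    refine ⟨ρ MSet.top, fun B => ?_⟩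
    rw [← additive_eq_of_ergodic hmp.measurable herg1 ρ (fun A => (hρ A).1) (fun A => ?_)
      (fun A D => ?_) (fun A => ?_) B]
    · exact hlim B
    · exact le_of_tendsto (hlim A) (Eventually.of_forall fun i => measureReal_mono inter_subset_left)
    · refine tendsto_nhds_unique (hlim A) (((hlim (A ∩ D)).add (hlim (A ∩ Dᶜ))).congr fun i => ?_)
      rw [← measureReal_inter_add_sdiff (s := ((A ∩ MSet.level (he.meas i) a : MSet X) : Set X)) D.2]
      congr 2
      · exact inter_right_comm _ _ _
      · exact inter_right_comm _ _ _
    · have hpre : ∀ i, μ.real ((A.pre hmp.measurable 1 ∩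
          (MSet.level (he.meas i) a).pre hmp.measurable 1 : MSet X) : Set X) =
          μ.real ((A ∩ MSet.level (he.meas i) a : MSet X) : Set X) := fun i =>
        (hmp.iterate 1).measureReal_preimage
          (A ∩ MSet.level (he.meas i) a : MSet X).2.nullMeasurableSet
      refine le_antisymm ?_ ?_
      · have h2 := (hlim A).add he.inv
        rw [add_zero] at h2
        refine le_of_tendsto_of_tendsto' (hlim _) h2 fun i => ?_
        rw [← hpre i]
        refine (measureReal_mono ?_).trans (measureReal_union_le _ _)
        rintro x ⟨hx1, hx2⟩
        by_cases h : e i (T x) = e i x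
        · exact Or.inl ⟨hx1, h.trans hx2⟩
        · exact Or.inr h
      · have h2 := (hlim (A.pre hmp.measurable 1)).add he.inv
        rw [add_zero] at h2
        refine le_of_tendsto_of_tendsto' (hlim _) h2 fun i => ?_
        rw [← hpre i]
        refine (measureReal_mono ?_).trans (measureReal_union_le _ _)
        rintro x ⟨hx1, hx2⟩
        by_cases h : e i (T x) = e i x
        · exact Or.inl ⟨hx1, h.symm.trans hx2⟩
        · exact Or.inr h
  choose p hp using hdens
  have hp' : ∀ a, Tendsto (fun i => μ.real (MSet.level (he.meas i) a : Set X)) 𝒰 (nhds (p a)) := by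
    intro a
    have := hp a MSet.top
    simp only [MSet.top_inter] at this
    simpa [MSet.top] using this
  obtain ⟨a, ha, ha'⟩ : ∃ a, p a ≠ 0 ∧ p (a + 1) ≠ 0 := by
    by_contra! hcon
    have hlim : Tendsto (fun i => ∑ a ∈ Finset.range (E + 1),
        2 * min (μ.real (MSet.level (he.meas i) a : Set X))
          (μ.real (MSet.level (he.meas i) (a + 1) : Set X))) 𝒰 (nhds 0) := by
      have h0 : (0 : ℝ) = ∑ a ∈ Finset.range (E + 1), 2 * min (p a) (p (a + 1)) := by
        refine (Finset.sum_eq_zero fun a _ => ?_).symm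
        have h1 : 0 ≤ p a := ge_of_tendsto' (hp' a) fun i => measureReal_nonneg
        have h2 : 0 ≤ p (a + 1) := ge_of_tendsto' (hp' (a + 1)) fun i => measureReal_nonneg
        by_cases h : p a = 0
        · rw [h, min_eq_left h2, mul_zero]
        · rw [hcon a h, min_eq_right h1, mul_zero]
      rw [h0]
      exact tendsto_finsetSum _ fun a _ => ((hp' a).min (hp' (a + 1))).const_mul 2
    obtain ⟨i, hi1, hi2⟩ := (hjump.and (hlim.eventually (gt_mem_nhds hη))).exists
    refine absurd (hi1.trans ?_) (not_le.2 hi2)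
    have hTw : ∀ b, μ.real (T^[w i] ⁻¹' (MSet.level (he.meas i) b : Set X)) =
        μ.real (MSet.level (he.meas i) b : Set X) := fun b =>
      (hmp.iterate (w i)).measureReal_preimage (MSet.level (he.meas i) b).2.nullMeasurableSet
    have hsub : {x | e i (T^[w i] x) = e i x + 1 ∨ e i x = e i (T^[w i] x) + 1} ⊆
        ⋃ a ∈ Finset.range (E + 1),
          (((MSet.level (he.meas i) a : Set X) ∩ T^[w i] ⁻¹' (MSet.level (he.meas i) (a + 1) : Set X)) ∪
          (T^[w i] ⁻¹' (MSet.level (he.meas i) a : Set X) ∩ (MSet.level (he.meas i) (a + 1) : Set X))) := by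
      rintro x (hx | hx)
      · exact mem_biUnion (Finset.mem_range.2 (Nat.lt_succ_of_le (hE i x))) (Or.inl ⟨rfl, hx⟩)
      · exact mem_biUnion (Finset.mem_range.2 (Nat.lt_succ_of_le (hE i (T^[w i] x))))
          (Or.inr ⟨rfl, hx⟩)
    refine (measureReal_mono hsub (measure_ne_top _ _)).trans ((measureReal_biUnion_finset_le _ _).trans
      (Finset.sum_le_sum fun a _ => ?_))
    refine (measureReal_union_le _ _).trans ?_
    rw [two_mul]
    refine add_le_add (le_min (measureReal_mono inter_subset_left) ?_) (le_min ?_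
      (measureReal_mono inter_subset_right))
    · rw [← hTw (a + 1)]; exact measureReal_mono inter_subset_right
    · rw [← hTw a]; exact measureReal_mono inter_subset_left
  refine ⟨hmp.iterate N, ⟨fun {F} hFm hF => ?_⟩⟩
  have hinv : ∀ k, F = T^[k * N] ⁻¹' F := by
    intro k
    induction k with
    | zero => simp
    | succ k ih =>
      rw [Nat.succ_mul, add_comm, Function.iterate_add, preimage_comp, hF]
      exact ih
  have hshift : ∀ a, p a ≠ 0 → T^[a] ⁻¹' F =ᵐ[μ] F := by
    intro a ha
    let S : MSet X := ⟨{x | ¬ (x ∈ F ↔ T^[a] x ∈ F)}, (hFm.iff (hmp.measurable.iterate a hFm)).compl⟩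
    have h0 : Tendsto (fun i => μ.real ((S ∩ MSet.level (he.meas i) a : MSet X) : Set X)) 𝒰
        (nhds 0) := by
      refine squeeze_zero (fun i => measureReal_nonneg) (fun i => measureReal_mono ?_) (he.ret F hFm)
      rintro x ⟨hx1, hx2⟩
      have hx2' : e i x = a := hx2
      simp only [mem_ofPred_eq, hx2']
      intro hiff
      refine hx1 (Iff.trans ?_ hiff)
      conv_lhs => rw [hinv (r i)]
      rfl
    have h1 := tendsto_nhds_unique (hp a S) h0
    have h2 : μ.real (S : Set X) = 0 := (mul_eq_zero.1 h1).resolve_left ha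
    have h3 : μ (S : Set X) = 0 := (measureReal_eq_zero_iff).1 h2
    refine (measure_symmDiff_eq_zero_iff).1 (measure_mono_null ?_ h3)
    rintro x (⟨hx1, hx2⟩ | ⟨hx1, hx2⟩)
    · exact fun hiff => hx2 (hiff.2 hx1)
    · exact fun hiff => hx2 (hiff.1 hx1)
  have hT1 : T ⁻¹' F =ᵐ[μ] F := by
    have h1 := hshift a ha
    have h2 := hshift (a + 1) ha'
    have h3 := hmp.quasiMeasurePreserving.preimage_ae_eq h1
    rw [← preimage_comp, ← Function.iterate_succ] at h3
    exact h3.symm.trans h2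
  exact hT.quasiErgodic.aeconst_set₀ hFm.nullMeasurableSet hT1

end Windows

section Rotation

/-- The indicator function of `[0, w) + ℤ`, written with floors. -/
noncomputable def arc (w y : ℝ) : ℤ := ⌊y⌋ - ⌊y - w⌋

theorem arc_eq {w : ℝ} (h0 : 0 ≤ w) (h1 : w ≤ 1) (y : ℝ) :
    arc w y = if Int.fract y < w then 1 else 0 := by
  have hy := Int.floor_add_fract y
  have hf0 := Int.fract_nonneg y
  have hf1 := Int.fract_lt_one y
  unfold arc
  split_ifs with h
  · have : ⌊y - w⌋ = ⌊y⌋ - 1 := by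
      rw [Int.floor_eq_iff]; push_cast; constructor <;> linarith
    omega
  · have : ⌊y - w⌋ = ⌊y⌋ := by
      rw [Int.floor_eq_iff]; constructor <;> linarith
    omega

theorem arc_add_int (w y : ℝ) (l : ℤ) : arc w (y + l) = arc w y := by
  unfold arc
  rw [show y + l - w = y - w + l by ring, Int.floor_add_intCast, Int.floor_add_intCast]
  ring

/-- The number of visits to `[0, z) + ℤ` among `x, x + α, …, x + (L - 1) α`. -/
noncomputable def hits (α z : ℝ) (L : ℕ) (x : ℝ) : ℕ :=
  ∑ i ∈ Finset.range L, if Int.fract (x + i * α) < z then 1 else 0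

theorem hits_cast {z : ℝ} (h0 : 0 ≤ z) (h1 : z ≤ 1) (α : ℝ) (L : ℕ) (x : ℝ) :
    (hits α z L x : ℤ) = ∑ i ∈ Finset.range L, arc z (x + i * α) := by
  unfold hits
  push_cast
  exact Finset.sum_congr rfl fun i _ => (arc_eq h0 h1 _).symm

theorem hits_add (α z : ℝ) (a b : ℕ) (x : ℝ) :
    hits α z (a + b) x = hits α z a x + hits α z b (x + a * α) := by
  unfold hits
  rw [Finset.sum_range_add]
  congr 1
  refine Finset.sum_congr rfl fun i _ => ?_
  push_cast
  rw [show x + (a + i) * α = x + a * α + i * α by ring]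

theorem hits_succ (α z : ℝ) (L : ℕ) (x : ℝ) :
    hits α z (L + 1) x = hits α z L x + if Int.fract (x + L * α) < z then 1 else 0 := by
  unfold hits
  rw [Finset.sum_range_succ]

theorem hits_add_int (α z : ℝ) (L : ℕ) (x : ℝ) (l : ℤ) :
    hits α z L (x + l) = hits α z L x := by
  unfold hits
  refine Finset.sum_congr rfl fun i _ => ?_
  rw [show x + l + i * α = x + i * α + l by ring, Int.fract_add_intCast]

theorem hits_fract (α z : ℝ) (L : ℕ) (x : ℝ) : hits α z L (Int.fract x) = hits α z L x := by
  conv_rhs => rw [← Int.fract_add_floor x]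
  rw [hits_add_int]

theorem measurable_hits (α z : ℝ) (L : ℕ) : Measurable (hits α z L) := by
  unfold hits
  refine Finset.measurable_sum _ fun i _ => ?_
  refine Measurable.ite ?_ measurable_const measurable_const
  exact measurableSet_lt (measurable_fract.comp (measurable_id.add_const _)) measurable_const

/-- The signed number of integers in `(y, y + s]`. -/
noncomputable def jump (s y : ℝ) : ℤ := ⌊y + s⌋ - ⌊y⌋

theorem exists_jump_eq (s : ℝ) :
    ∃ σ : ℤ, (σ = 1 ∨ σ = -1) ∧ ∀ y, jump s y = σ * arc |s| (y + max s 0) := by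
  rcases le_total 0 s with h | h
  · refine ⟨1, Or.inl rfl, fun y => ?_⟩
    rw [abs_of_nonneg h, max_eq_left h, jump, arc]
    simp
  · refine ⟨-1, Or.inr rfl, fun y => ?_⟩
    rw [abs_of_nonpos h, max_eq_right h, jump, arc]
    simp

theorem hits_shift {z : ℝ} (h0 : 0 ≤ z) (h1 : z ≤ 1) (α : ℝ) (N L : ℕ) (l : ℤ) (x : ℝ) :
    (hits α z N (x + L * α) : ℤ) - hits α z N x =
      ∑ t ∈ Finset.range L, jump (N * α - l) (x + t * α) -
        ∑ t ∈ Finset.range L, jump (N * α - l) (x - z + t * α) := by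
  rw [← Finset.sum_sub_distrib]
  induction L with
  | zero => simp
  | succ L ih =>
    rw [Finset.sum_range_succ, ← ih]
    have h2 : (hits α z N (x + (L + 1 : ℕ) * α) : ℤ) - hits α z N (x + L * α) =
        arc z (x + L * α + N * α) - arc z (x + L * α) := by
      have e1 := hits_succ α z N (x + L * α)
      have e2 := hits_add α z 1 N (x + L * α)
      rw [add_comm 1 N] at e2
      have e3 : hits α z 1 (x + L * α) = if Int.fract (x + L * α) < z then 1 else 0 := by
        simp only [hits, Finset.sum_range_one, Nat.cast_zero, zero_mul, add_zero]
      rw [arc_eq h0 h1, arc_eq h0 h1]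
      rw [show x + (L + 1 : ℕ) * α = x + L * α + (1 : ℕ) * α by push_cast; ring]
      rw [e1, e3] at e2
      have e4 := congrArg (Nat.cast : ℕ → ℤ) e2
      push_cast at e4 ⊢
      linarith
    have h3 : arc z (x + L * α + N * α) - arc z (x + L * α) =
        jump (N * α - l) (x + L * α) - jump (N * α - l) (x - z + L * α) := by
      rw [show x + L * α + N * α = x + L * α + (N * α - l) + l by ring, arc_add_int]
      simp only [arc, jump]
      rw [show x + L * α + (N * α - l) - z = x - z + L * α + (N * α - l) by ring,
        show x + L * α - z = x - z + L * α by ring]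
      ring
    linarith

theorem card_hits_le {α : ℝ} {q : ℕ} {p : ℤ} (hq : 0 < q) (hcop : IsCoprime (q : ℤ) p)
    (hδ : q * |q * α - p| < 1) {w : ℝ} (hw : 0 ≤ w) (y : ℝ) :
    (hits α w q y : ℝ) ≤ q * w + 3 := by
  have hq' : (0 : ℝ) < q := by exact_mod_cast hq
  have hcard : hits α w q y = ((Finset.range q).filter fun i : ℕ => Int.fract (y + i * α) < w).card := by
    unfold hits; rw [Finset.card_filter]
  set S := (Finset.range q).filter fun i : ℕ => Int.fract (y + i * α) < w with hS
  let g : ℕ → ℤ := fun i => i * p - ⌊y + i * α⌋ * q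
  have hg : ∀ i ∈ S, g i ∈ Finset.Icc ⌈-(q * y) - 1⌉ ⌊q * w - q * y + 1⌋ := by
    intro i hi
    rw [hS, Finset.mem_filter, Finset.mem_range] at hi
    have hi' : (i : ℝ) ≤ q := by exact_mod_cast hi.1.le
    have hf := Int.floor_add_fract (y + i * α)
    have hf0 := Int.fract_nonneg (y + i * α)
    have hb : |i * (q * α - p)| < 1 := by
      rw [abs_mul, Nat.abs_cast]
      refine lt_of_le_of_lt ?_ hδ
      gcongr
    rw [abs_lt] at hb
    have heq : ((g i : ℤ) : ℝ) = q * Int.fract (y + i * α) - q * y - i * (q * α - p) := by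
      simp only [g]
      push_cast
      rw [Int.fract]
      ring
    have h3 : q * Int.fract (y + i * α) ≤ q * w := by
      gcongr
      exact hi.2.le
    have h4 : 0 ≤ q * Int.fract (y + i * α) := by positivity
    rw [Finset.mem_Icc, Int.ceil_le, Int.le_floor, heq]
    constructor <;> linarith
  have hinj : Set.InjOn g S := by
    intro i hi j hj hij
    rw [hS, Finset.mem_coe, Finset.mem_filter, Finset.mem_range] at hi hj
    have hdvd : (q : ℤ) ∣ (i - j) * p := by
      refine ⟨⌊y + i * α⌋ - ⌊y + j * α⌋, ?_⟩
      simp only [g] at hij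
      linear_combination hij
    have hdvd' : (q : ℤ) ∣ i - j := hcop.dvd_of_dvd_mul_right hdvd
    have := Int.eq_zero_of_abs_lt_dvd hdvd' (by rw [abs_lt]; constructor <;> omega)
    omega
  have hle := Finset.card_le_card_of_injOn g hg hinj
  rw [Int.card_Icc] at hle
  rw [hcard]
  have h5 : (⌊q * w - q * y + 1⌋ : ℝ) + 1 - ⌈-(q * y) - 1⌉ ≤ q * w + 3 := by
    have := Int.floor_le (q * w - q * y + 1)
    have := Int.le_ceil (-(q * y) - 1)
    linarith
  have h6 : (S.card : ℤ) ≤ max (⌊q * w - q * y + 1⌋ + 1 - ⌈-(q * y) - 1⌉) 0 := by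
    rw [← Int.toNat_eq_max]
    exact_mod_cast hle
  have h7 : (S.card : ℝ) ≤ max ((⌊q * w - q * y + 1⌋ : ℝ) + 1 - ⌈-(q * y) - 1⌉) 0 := by
    exact_mod_cast h6
  exact h7.trans (max_le h5 (by positivity))

/-- The Denjoy-Koksma inequality for visits to an interval. -/
theorem abs_hits_sub_le {α : ℝ} {q : ℕ} {p : ℤ} (hq : 0 < q) (hcop : IsCoprime (q : ℤ) p)
    (hδ : q * |q * α - p| < 1) {z : ℝ} (h0 : 0 ≤ z) (h1 : z ≤ 1) (y : ℝ) :
    |(hits α z q y : ℝ) - q * z| ≤ 3 := by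
  have hA := card_hits_le hq hcop hδ h0 y
  have hB := card_hits_le hq hcop hδ (w := 1 - z) (by linarith) (y - z)
  have hsum : (hits α z q y : ℤ) + hits α (1 - z) q (y - z) = q := by
    rw [hits_cast h0 h1, hits_cast (by linarith) (by linarith), ← Finset.sum_add_distrib]
    have : ∀ i ∈ Finset.range q, arc z (y + i * α) + arc (1 - z) (y - z + i * α) = 1 := by
      intro i _
      simp only [arc]
      rw [show y - z + i * α - (1 - z) = y + i * α - 1 by ring, Int.floor_sub_one,
        show y - z + i * α = y + i * α - z by ring]
      ring
    rw [Finset.sum_congr rfl this]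
    simp
  have hsum' : (hits α z q y : ℝ) + hits α (1 - z) q (y - z) = q := by exact_mod_cast hsum
  rw [abs_le]
  constructor <;> linarith

theorem abs_hits_mul_sub_le {α : ℝ} {q : ℕ} {p : ℤ} (hq : 0 < q) (hcop : IsCoprime (q : ℤ) p)
    (hδ : q * |q * α - p| < 1) {z : ℝ} (h0 : 0 ≤ z) (h1 : z ≤ 1) (m : ℕ) (y : ℝ) :
    |(hits α z (m * q) y : ℝ) - m * (q * z)| ≤ 3 * m := by
  induction m generalizing y with
  | zero => simp [hits]
  | succ m ih =>
    rw [Nat.succ_mul, hits_add]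
    have h2 := ih y
    have h3 := abs_hits_sub_le hq hcop hδ h0 h1 (y + (m * q : ℕ) * α)
    rw [abs_le] at *
    push_cast at *
    constructor <;> linarith

namespace GoodScale

variable {α z κ : ℝ} {q : ℕ} {p : ℤ}

theorem abs_pos (h : GoodScale α z κ q p) (hκ : 0 < κ) : 0 < |q * α - p| := by
  refine lt_of_le_of_ne (abs_nonneg _) fun h0 => ?_
  have hl := h.lower
  rw [← h0, mul_zero] at hl
  linarith

theorem gap_two (h : GoodScale α z κ q p) (hκ : 0 < κ) (hκ1 : κ < 1) {j : ℤ} (l : ℤ) (hj : j ≠ 0)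
    (hjq : |(j : ℝ)| < κ * q) : 2 * |q * α - p| ≤ |j * α - l| := by
  have hq : (0 : ℝ) < q := by exact_mod_cast h.pos
  have hjq' := abs_lt.1 hjq
  have hlt : κ * q < q := by nlinarith
  have h0 := h.gap j l hj (by linarith)
  have h1 := h.gap (j - q) (l - p) (by
    intro hcon
    have : (j : ℝ) = q := by exact_mod_cast sub_eq_zero.1 hcon
    linarith) (by push_cast; rw [abs_lt]; constructor <;> linarith)
  have h2 := h.gap (j + q) (l + p) (by
    intro hcon
    have : (j : ℝ) = -q := by exact_mod_cast eq_neg_of_add_eq_zero_left hcon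
    linarith) (by push_cast; rw [abs_lt]; constructor <;> linarith)
  push_cast at h1 h2
  have e1 : ((j : ℝ) - q) * α - (l - p) = (j * α - l) - (q * α - p) := by ring
  have e2 : ((j : ℝ) + q) * α - (l + p) = (j * α - l) + (q * α - p) := by ring
  rw [e1] at h1
  rw [e2] at h2
  have hpos := h.abs_pos hκ
  generalize (j : ℝ) * α - l = t at *
  generalize (q : ℝ) * α - p = s at *
  rcases abs_cases t with ⟨ht, _⟩ | ⟨ht, _⟩ <;> rcases abs_cases s with ⟨hs, _⟩ | ⟨hs, _⟩ <;>
    rcases abs_cases (t - s) with ⟨hts, _⟩ | ⟨hts, _⟩ <;>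
    rcases abs_cases (t + s) with ⟨hts', _⟩ | ⟨hts', _⟩ <;> linarith

/-- In a short window the orbit visits an interval of length `n ‖q α‖` fewer than `n` times. -/
theorem sum_arc_le (h : GoodScale α z κ q p) (hκ : 0 < κ) (hκ1 : κ < 1) {n : ℕ} (hn : 2 ≤ n)
    (hnq : n * |q * α - p| ≤ 1) {L : ℕ} (hL : (L : ℝ) ≤ κ * q) (y : ℝ) :
    ∑ t ∈ Finset.range L, arc (n * |q * α - p|) (y + t * α) ≤ n - 1 := by
  have hpos := h.abs_pos hκ
  set δ := |q * α - p| with hδ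
  have hsum : ∑ t ∈ Finset.range L, arc (n * δ) (y + t * α) =
      (((Finset.range L).filter fun t : ℕ => Int.fract (y + t * α) < n * δ).card : ℤ) := by
    rw [Finset.card_filter]
    push_cast
    exact Finset.sum_congr rfl fun t _ => arc_eq (by positivity) hnq _
  rw [hsum]
  set S := (Finset.range L).filter fun t : ℕ => Int.fract (y + t * α) < n * δ with hS
  let g : ℕ → ℕ := fun t => ⌊Int.fract (y + t * α) / (2 * δ)⌋₊
  have hg : ∀ t ∈ S, g t ∈ Finset.range (n - 1) := by
    intro t ht
    rw [hS, Finset.mem_filter] at ht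
    have h1 : (g t : ℝ) ≤ Int.fract (y + t * α) / (2 * δ) :=
      Nat.floor_le (div_nonneg (Int.fract_nonneg _) (by positivity))
    rw [le_div_iff₀ (by positivity)] at h1
    have h2 : 2 * (g t : ℝ) < n := by
      by_contra! hcon
      nlinarith [ht.2]
    have h3 : 2 * g t < n := by exact_mod_cast h2
    rw [Finset.mem_range]
    omega
  have hinj : Set.InjOn g S := by
    intro t ht t' ht' hij
    by_contra hne
    rw [hS, Finset.mem_coe, Finset.mem_filter, Finset.mem_range] at ht ht'
    have hfl := Nat.floor_le (div_nonneg (Int.fract_nonneg (y + t * α))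
      (show 0 ≤ 2 * δ by positivity))
    have hfl' := Nat.floor_le (div_nonneg (Int.fract_nonneg (y + t' * α))
      (show 0 ≤ 2 * δ by positivity))
    have hlt := Nat.lt_floor_add_one (Int.fract (y + t * α) / (2 * δ))
    have hlt' := Nat.lt_floor_add_one (Int.fract (y + t' * α) / (2 * δ))
    simp only [g] at hij
    rw [hij] at hfl hlt
    have hd : |Int.fract (y + t * α) / (2 * δ) - Int.fract (y + t' * α) / (2 * δ)| < 1 := by
      rw [abs_lt]; constructor <;> linarith
    rw [← sub_div, abs_div, abs_of_pos (show 0 < 2 * δ by positivity),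
      div_lt_one (by positivity)] at hd
    have hgap := h.gap_two hκ hκ1 (j := t - t') (⌊y + t * α⌋ - ⌊y + t' * α⌋)
      (sub_ne_zero.2 (by exact_mod_cast hne)) (by
        have h1 : (t : ℝ) < L := by exact_mod_cast ht.1
        have h2 : (t' : ℝ) < L := by exact_mod_cast ht'.1
        have h3 : (0 : ℝ) ≤ t := by positivity
        have h4 : (0 : ℝ) ≤ t' := by positivity
        push_cast
        rw [abs_lt]; constructor <;> linarith)
    push_cast at hgap
    rw [show ((t : ℝ) - t') * α - (⌊y + t * α⌋ - ⌊y + t' * α⌋) =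
      Int.fract (y + t * α) - Int.fract (y + t' * α) by rw [Int.fract, Int.fract]; ring] at hgap
    linarith
  have hle := Finset.card_le_card_of_injOn g hg hinj
  rw [Finset.card_range] at hle
  omega

theorem sum_arc_nonneg {w : ℝ} (h0 : 0 ≤ w) (h1 : w ≤ 1) (L : ℕ) (y : ℝ) :
    0 ≤ ∑ t ∈ Finset.range L, arc w (y + t * α) :=
  Finset.sum_nonneg fun t _ => by rw [arc_eq h0 h1]; split_ifs <;> simp

/-- In a short window the number of visits during time `n q` changes by less than `n`. -/
theorem abs_hits_shift_lt (h : GoodScale α z κ q p) (hκ : 0 < κ) (hκ1 : κ < 1) (h0 : 0 ≤ z)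
    (h1 : z ≤ 1) {n : ℕ} (hn : 2 ≤ n) (hnq : n ≤ q) {L : ℕ} (hL : (L : ℝ) ≤ κ * q) (x : ℝ) :
    |(hits α z (n * q) (x + L * α) : ℤ) - hits α z (n * q) x| < n := by
  have hδ1 : n * |q * α - p| ≤ 1 := by
    have : (n : ℝ) ≤ q := by exact_mod_cast hnq
    refine le_trans ?_ h.upper.le
    gcongr
  rw [hits_shift h0 h1 α (n * q) L (n * p)]
  have hs : ((n * q : ℕ) : ℝ) * α - ((n * p : ℤ) : ℝ) = n * (q * α - p) := by push_cast; ring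
  rw [hs]
  obtain ⟨σ, hσ, hj⟩ := exists_jump_eq (n * (q * α - p))
  simp only [hj, ← Finset.mul_sum]
  rw [abs_mul, Nat.abs_cast]
  have e1 : ∀ (y : ℝ) (t : ℕ), y + t * α + max (n * (q * α - p)) 0 =
    (y + max (n * (q * α - p)) 0) + t * α := fun y t => by ring
  simp only [e1]
  have a1 := h.sum_arc_le hκ hκ1 hn hδ1 hL (x + max (n * (q * α - p)) 0)
  have a2 := h.sum_arc_le hκ hκ1 hn hδ1 hL (x - z + max (n * (q * α - p)) 0)
  have a3 := sum_arc_nonneg (α := α) (by positivity) hδ1 L (x + max (n * (q * α - p)) 0)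
  have a4 := sum_arc_nonneg (α := α) (by positivity) hδ1 L (x - z + max (n * (q * α - p)) 0)
  rw [← mul_sub, abs_mul]
  have hσ1 : |σ| = 1 := by rcases hσ with rfl | rfl <;> simp
  rw [hσ1, one_mul, abs_lt]
  constructor <;> linarith

/-- If the orbit visits the interval of length `‖q α‖` in a short window, then the number of visits
during time `q` changes by one. -/
theorem abs_hits_shift_eq_one (h : GoodScale α z κ q p) (hκ : 0 < κ) (h0 : 0 ≤ z) (h1 : z ≤ 1)
    {L : ℕ} (hL : (L : ℝ) ≤ κ * q) {x : ℝ} {t₀ : ℕ} (ht₀ : t₀ < L)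
    (hx : Int.fract (x + t₀ * α + max (q * α - p) 0) < |q * α - p|) :
    |(hits α z q (x + L * α) : ℤ) - hits α z q x| = 1 := by
  have hpos := h.abs_pos hκ
  have hq : (1 : ℝ) ≤ q := by exact_mod_cast h.pos
  have hδ1 : |q * α - p| ≤ 1 := by nlinarith [h.upper]
  rw [hits_shift h0 h1 α q L p]
  obtain ⟨σ, hσ, hj⟩ := exists_jump_eq (q * α - p)
  simp only [hj, ← Finset.mul_sum]
  rw [← mul_sub, abs_mul]
  have hσ1 : |σ| = 1 := by rcases hσ with rfl | rfl <;> simp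
  set s := max (q * α - p) 0
  set δ := |q * α - p|
  have htL : ∀ t < L, |((t : ℤ) - (t₀ : ℤ) : ℤ)| < κ * q := by
    intro t ht
    have h2 : (t : ℝ) < L := by exact_mod_cast ht
    have h3 : (t₀ : ℝ) < L := by exact_mod_cast ht₀
    have h4 : (0 : ℝ) ≤ t := by positivity
    have h5 : (0 : ℝ) ≤ t₀ := by positivity
    push_cast
    rw [abs_lt]; constructor <;> linarith
  have hdiff : ∀ y : ℝ, Int.fract y < δ → |Int.fract y - Int.fract (x + t₀ * α + s)| < δ := by
    intro y hy
    have := Int.fract_nonneg y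
    have := Int.fract_nonneg (x + t₀ * α + s)
    rw [abs_lt]; constructor <;> linarith
  have hfirst : ∑ t ∈ Finset.range L, arc δ (x + t * α + s) = 1 := by
    rw [Finset.sum_eq_single_of_mem t₀ (Finset.mem_range.2 ht₀)]
    · rw [arc_eq hpos.le hδ1, if_pos hx]
    · intro t ht hne
      rw [Finset.mem_range] at ht
      rw [arc_eq hpos.le hδ1, if_neg]
      intro hcon
      have hgap := h.gap (t - t₀) (⌊x + t * α + s⌋ - ⌊x + t₀ * α + s⌋)
        (sub_ne_zero.2 (by exact_mod_cast hne)) (by have := htL t ht; push_cast at this ⊢; linarith)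
      have hlt := hdiff _ hcon
      push_cast at hgap
      rw [show ((t : ℝ) - t₀) * α - (⌊x + t * α + s⌋ - ⌊x + t₀ * α + s⌋) =
        Int.fract (x + t * α + s) - Int.fract (x + t₀ * α + s) by
          rw [Int.fract, Int.fract]; ring] at hgap
      exact absurd hlt (not_lt.2 hgap)
  have hsecond : ∑ t ∈ Finset.range L, arc δ (x - z + t * α + s) = 0 := by
    refine Finset.sum_eq_zero fun t ht => ?_
    rw [Finset.mem_range] at ht
    rw [arc_eq hpos.le hδ1, if_neg]
    intro hcon
    have hsep := h.sep (t - t₀) (⌊x - z + t * α + s⌋ - ⌊x + t₀ * α + s⌋)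
      (by have := htL t ht; push_cast at this ⊢; exact this)
    have hlt := hdiff _ hcon
    push_cast at hsep
    rw [show ((t : ℝ) - t₀) * α - z - (⌊x - z + t * α + s⌋ - ⌊x + t₀ * α + s⌋) =
      Int.fract (x - z + t * α + s) - Int.fract (x + t₀ * α + s) by
        rw [Int.fract, Int.fract]; ring] at hsep
    exact absurd hlt (not_lt.2 hsep)
  rw [hfirst, hsecond, hσ1]
  norm_num

end GoodScale

end Rotation

section InducedRotation

/-- The first point of the orbit of `y` under the rotation by `α` in `[0, z)`, if the complement of
`[0, z)` is mapped into `[0, z)`. -/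
noncomputable def nextVisit (α z y : ℝ) : ℝ :=
  if Int.fract y < z then Int.fract y else Int.fract (y + α)

/-- `T` is a measurable map that on `[0, z)` is induced by the rotation by `α`, with return times
at most two. -/
structure IsInducedRotation (α z : ℝ) (T : ℝ → ℝ) : Prop where
  pos : 0 < z
  le_one : z ≤ 1
  next : ∀ y, ¬ Int.fract y < z → Int.fract (y + α) < z
  eq : ∀ x ∈ Ico 0 z, T x = nextVisit α z (x + α)
  meas : Measurable T

theorem fract_fract_add (y b : ℝ) : Int.fract (Int.fract y + b) = Int.fract (y + b) := by
  conv_rhs => rw [← Int.fract_add_floor y, add_right_comm, Int.fract_add_intCast]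

theorem nextVisit_fract (α z y : ℝ) : nextVisit α z (Int.fract y) = nextVisit α z y := by
  unfold nextVisit
  rw [Int.fract_fract, fract_fract_add]

theorem nextVisit_add_int (α z y : ℝ) (l : ℤ) : nextVisit α z (y + l) = nextVisit α z y := by
  rw [← nextVisit_fract, Int.fract_add_intCast, nextVisit_fract]

theorem measurable_nextVisit (α z : ℝ) : Measurable (nextVisit α z) :=
  Measurable.ite (measurableSet_lt measurable_fract measurable_const) measurable_fract
    (measurable_fract.comp (measurable_id.add_const _))

theorem fract_eq_self_of_mem {z x : ℝ} (hz1 : z ≤ 1) (hx : x ∈ Ico 0 z) : Int.fract x = x :=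
  Int.fract_eq_self.2 ⟨hx.1, hx.2.trans_le hz1⟩

namespace IsInducedRotation

variable {α z : ℝ} {T : ℝ → ℝ}

theorem nextVisit_mem (h : IsInducedRotation α z T) (y : ℝ) : nextVisit α z y ∈ Ico 0 z := by
  unfold nextVisit
  split_ifs with hy
  · exact ⟨Int.fract_nonneg _, hy⟩
  · exact ⟨Int.fract_nonneg _, h.next y hy⟩

theorem apply_fract (h : IsInducedRotation α z T) {y : ℝ} (hy : Int.fract y < z) :
    T (Int.fract y) = nextVisit α z (y + α) := by
  rw [h.eq _ ⟨Int.fract_nonneg _, hy⟩, ← nextVisit_fract, fract_fract_add, nextVisit_fract]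

theorem nextVisit_add (h : IsInducedRotation α z T) {y : ℝ} (hy : ¬ Int.fract y < z) :
    nextVisit α z (y + α) = nextVisit α z y := by
  have := h.next y hy
  unfold nextVisit
  rw [if_neg hy, if_pos this]

theorem mapsTo (h : IsInducedRotation α z T) {x : ℝ} (hx : x ∈ Ico 0 z) : T x ∈ Ico 0 z := by
  rw [h.eq x hx]; exact h.nextVisit_mem _

theorem iterate_mem (h : IsInducedRotation α z T) {x : ℝ} (hx : x ∈ Ico 0 z) (k : ℕ) :
    T^[k] x ∈ Ico 0 z := by
  induction k with
  | zero => exact hx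
  | succ k ih => rw [Function.iterate_succ_apply']; exact h.mapsTo ih

theorem iterate_hits (h : IsInducedRotation α z T) {x : ℝ} (hx : x ∈ Ico 0 z) (L : ℕ) :
    T^[hits α z L x] x = nextVisit α z (x + L * α) := by
  induction L with
  | zero =>
    have hf := fract_eq_self_of_mem h.le_one hx
    simp [hits, nextVisit, hf, hx.2]
  | succ L ih =>
    rw [hits_succ, show x + (L + 1 : ℕ) * α = x + L * α + α by push_cast; ring]
    split_ifs with hL
    · rw [Function.iterate_succ_apply', ih, ← h.apply_fract hL]
      congr 1
      unfold nextVisit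
      rw [if_pos hL]
    · rw [add_zero, ih, h.nextVisit_add hL]

theorem exists_iterate_eq (h : IsInducedRotation α z T) {x : ℝ} (hx : x ∈ Ico 0 z) (w : ℕ) :
    ∃ L, w ≤ L ∧ L ≤ 2 * w ∧ T^[w] x = Int.fract (x + L * α) := by
  induction w with
  | zero => exact ⟨0, le_rfl, le_rfl, by simp [fract_eq_self_of_mem h.le_one hx]⟩
  | succ w ih =>
    obtain ⟨L, hL1, hL2, hL⟩ := ih
    have hmem := h.iterate_mem hx w
    rw [hL] at hmem
    rw [Function.iterate_succ_apply', hL, h.apply_fract hmem.2]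
    unfold nextVisit
    split_ifs with hy
    · exact ⟨L + 1, by omega, by omega, by congr 1; push_cast; ring⟩
    · exact ⟨L + 2, by omega, by omega, by congr 1; push_cast; ring⟩

end IsInducedRotation

theorem volume_periodic_inter {A : Set ℝ} (hA : MeasurableSet A) (hp : ∀ x, x + 1 ∈ A ↔ x ∈ A)
    (b : ℝ) : volume (A ∩ Ico b (b + 1)) = volume (A ∩ Ico 0 1) := by
  have hint : ∀ (l : ℤ) (x : ℝ), x + l ∈ A ↔ x ∈ A := by
    intro l
    induction l using Int.induction_on with
    | zero => simp
    | succ i ih =>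
      intro x
      rw [← ih x, ← hp (x + (i : ℤ))]
      push_cast
      rw [add_assoc]
    | pred i ih =>
      intro x
      rw [← ih x, ← hp (x + ((-i - 1 : ℤ) : ℝ))]
      push_cast
      rw [show x + (-(i : ℝ) - 1) + 1 = x + -i by ring]
  have h1 : ∀ c : ℝ, volume (A ∩ Ico c (c + 1)) = volume (A ∩ Ioc c (c + 1)) := fun c =>
    measure_congr ((ae_eq_refl A).inter Ico_ae_eq_Ioc)
  have h2 := h1 0
  rw [zero_add] at h2
  rw [h1 b, h2]
  have h3 := isAddFundamentalDomain_Ioc one_pos b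
  have h4 := isAddFundamentalDomain_Ioc one_pos (0 : ℝ)
  rw [zero_add] at h4
  refine h3.measure_set_eq h4 hA fun g => ?_
  obtain ⟨g, hg⟩ := g
  obtain ⟨l, rfl⟩ := AddSubgroup.mem_zmultiples_iff.1 hg
  ext x
  simp only [mem_preimage]
  rw [← hint l x]
  simp [AddSubgroup.vadd_def, add_comm]

theorem volume_preimage_add_periodic {A : Set ℝ} (hA : MeasurableSet A)
    (hp : ∀ x, x + 1 ∈ A ↔ x ∈ A) (b : ℝ) :
    volume ((fun x => x + b) ⁻¹' A ∩ Ico 0 1) = volume (A ∩ Ico 0 1) := by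
  rw [← volume_periodic_inter hA hp b, ← measure_preimage_add_right volume b (A ∩ Ico b (b + 1))]
  congr 1
  ext x
  simp only [mem_inter_iff, mem_preimage, mem_Ico]
  constructor
  · rintro ⟨h1, h2, h3⟩; exact ⟨h1, by linarith, by linarith⟩
  · rintro ⟨h1, h2, h3⟩; exact ⟨h1, by linarith, by linarith⟩

theorem fract_add_one_iff (P : ℝ → Prop) (x : ℝ) : P (Int.fract (x + 1)) ↔ P (Int.fract x) := by
  rw [Int.fract_add_one]

theorem volume_fract_lt {w : ℝ} (h1 : w ≤ 1) (b : ℝ) :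
    volume ({x | Int.fract (x + b) < w} ∩ Ico 0 1) = ENNReal.ofReal w := by
  have h := volume_preimage_add_periodic (A := {x | Int.fract x < w})
    (measurableSet_lt measurable_fract measurable_const)
    (fun x => fract_add_one_iff (fun y => y < w) x) b
  have h2 : {x | Int.fract x < w} ∩ Ico (0 : ℝ) 1 = Ico 0 w := by
    ext x
    simp only [mem_inter_iff, mem_ofPred_eq, mem_Ico]
    constructor
    · rintro ⟨hx, h0, h1⟩
      rw [Int.fract_eq_self.2 ⟨h0, h1⟩] at hx
      exact ⟨h0, hx⟩
    · rintro ⟨h0, hx⟩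
      exact ⟨by rw [Int.fract_eq_self.2 ⟨h0, hx.trans_le h1⟩]; exact hx, h0, hx.trans_le h1⟩
  rw [h2, Real.volume_Ico, sub_zero] at h
  exact h

theorem lebJ_apply (z : ℝ) (S : Set ℝ) :
    lebJ z S = (ENNReal.ofReal z)⁻¹ * volume (Ico 0 z ∩ S) := by
  rw [lebJ, ProbabilityTheory.cond_apply measurableSet_Ico, Real.volume_Ico, sub_zero]

theorem lebJ_real {z : ℝ} (hz : 0 < z) (S : Set ℝ) :
    (lebJ z).real S = z⁻¹ * volume.real (Ico 0 z ∩ S) := by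
  rw [Measure.real, lebJ_apply, ENNReal.toReal_mul, ENNReal.toReal_inv,
    ENNReal.toReal_ofReal hz.le, Measure.real]

theorem isProbabilityMeasure_lebJ {z : ℝ} (hz : 0 < z) : IsProbabilityMeasure (lebJ z) := by
  refine ProbabilityTheory.cond_isProbabilityMeasure_of_finite ?_ ?_
  · rw [Real.volume_Ico, sub_zero]; exact (ENNReal.ofReal_pos.2 hz).ne'
  · rw [Real.volume_Ico]; exact ENNReal.ofReal_ne_top

theorem ae_lebJ_mem (z : ℝ) : ∀ᵐ x ∂lebJ z, x ∈ Ico 0 z := by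
  rw [ae_iff, lebJ_apply]
  have : Ico 0 z ∩ {a | a ∉ Ico 0 z} = ∅ := by ext x; simp
  rw [this]; simp

namespace IsInducedRotation

variable {α z : ℝ} {T : ℝ → ℝ}

theorem volume_Ico_inter_preimage (h : IsInducedRotation α z T) {B : Set ℝ}
    (hB : MeasurableSet B) : volume (Ico 0 z ∩ T ⁻¹' B) = volume (Ico 0 z ∩ B) := by
  set G : Set ℝ := {y | Int.fract y < z} with hG
  set S : Set ℝ := {y | nextVisit α z y ∈ B} with hS
  have hGm : MeasurableSet G := measurableSet_lt measurable_fract measurable_const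
  have hSm : MeasurableSet S := measurable_nextVisit α z hB
  have hSp : ∀ x, x + 1 ∈ S ↔ x ∈ S := fun x => by
    have := nextVisit_add_int α z x 1
    rw [Int.cast_one] at this
    simp only [hS, mem_ofPred_eq, this]
  have hGJ : ∀ x, x ∈ Ico 0 z ↔ x ∈ G ∧ x ∈ Ico (0 : ℝ) 1 := by
    intro x
    constructor
    · intro hx
      refine ⟨?_, hx.1, hx.2.trans_le h.le_one⟩
      rw [hG, mem_ofPred_eq, fract_eq_self_of_mem h.le_one hx]
      exact hx.2
    · rintro ⟨hx, h0, h1⟩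
      rw [hG, mem_ofPred_eq, Int.fract_eq_self.2 ⟨h0, h1⟩] at hx
      exact ⟨h0, hx⟩
  have hshift := volume_preimage_add_periodic hSm hSp α
  set S' : Set ℝ := (fun x => x + α) ⁻¹' S with hS'
  have hS'm : MeasurableSet S' := (measurable_id.add_const α) hSm
  rw [← measure_inter_add_sdiff (S' ∩ Ico 0 1) hGm, ← measure_inter_add_sdiff (S ∩ Ico 0 1) hGm]
    at hshift
  have hdiff : (S' ∩ Ico 0 1) \ G = (S ∩ Ico 0 1) \ G := by
    ext x
    simp only [Set.mem_sdiff, mem_inter_iff]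
    refine and_congr_left fun hx => and_congr_left fun _ => ?_
    simp only [hS', hS, mem_preimage, mem_ofPred_eq]
    rw [h.nextVisit_add hx]
  rw [hdiff, ENNReal.add_left_inj (ne_top_of_le_ne_top (b := volume (Ico (0 : ℝ) 1))
    (by simp) (measure_mono fun x hx => hx.1.2))] at hshift
  have e1 : Ico 0 z ∩ T ⁻¹' B = S' ∩ Ico 0 1 ∩ G := by
    ext x
    constructor
    · rintro ⟨hx, hx'⟩
      refine ⟨⟨?_, ((hGJ x).1 hx).2⟩, ((hGJ x).1 hx).1⟩
      rw [mem_preimage, h.eq x hx] at hx'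
      exact hx'
    · rintro ⟨⟨h1, h2⟩, h3⟩
      have hx := (hGJ x).2 ⟨h3, h2⟩
      refine ⟨hx, ?_⟩
      rw [mem_preimage, h.eq x hx]
      exact h1
  have e2 : Ico 0 z ∩ B = S ∩ Ico 0 1 ∩ G := by
    ext x
    have key : x ∈ Ico 0 z → nextVisit α z x = x := fun hx => by
      have := fract_eq_self_of_mem h.le_one hx
      rw [nextVisit, if_pos (by rw [this]; exact hx.2), this]
    constructor
    · rintro ⟨hx, hx'⟩
      refine ⟨⟨?_, ((hGJ x).1 hx).2⟩, ((hGJ x).1 hx).1⟩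
      rw [hS, mem_ofPred_eq, key hx]
      exact hx'
    · rintro ⟨⟨h1, h2⟩, h3⟩
      have hx := (hGJ x).2 ⟨h3, h2⟩
      rw [hS, mem_ofPred_eq, key hx] at h1
      exact ⟨hx, h1⟩
  rw [e1, e2, hshift]

theorem measurePreserving (h : IsInducedRotation α z T) : MeasurePreserving T (lebJ z) (lebJ z) := by
  refine ⟨h.meas, Measure.ext fun B hB => ?_⟩
  rw [Measure.map_apply h.meas hB, lebJ_apply, lebJ_apply, h.volume_Ico_inter_preimage hB]

theorem ergodic (h : IsInducedRotation α z T) (hα : Irrational α) : Ergodic T (lebJ z) := by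
  refine ⟨h.measurePreserving, ⟨fun {F} hF hinv => ?_⟩⟩
  have : Fact ((0 : ℝ) < 1) := ⟨one_pos⟩
  have hstep : ∀ y, nextVisit α z (y + α) ∈ F ↔ nextVisit α z y ∈ F := by
    intro y
    by_cases hy : Int.fract y < z
    · rw [← h.apply_fract hy, ← mem_preimage, hinv, nextVisit, if_pos hy]
    · rw [h.nextVisit_add hy]
  let S : Set (AddCircle (1 : ℝ)) := {y | nextVisit α z (AddCircle.equivIco 1 0 y) ∈ F}
  have hSmem : ∀ x : ℝ, (x : AddCircle (1 : ℝ)) ∈ S ↔ nextVisit α z x ∈ F := by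
    intro x
    simp only [S, mem_ofPred_eq]
    rw [AddCircle.coe_equivIco_mk_apply]
    simp only [div_one, mul_one]
    rw [nextVisit_fract]
  have hSm : MeasurableSet S := by
    have h1 : Measurable fun y : AddCircle (1 : ℝ) => ((AddCircle.equivIco 1 0 y : Ico (0 : ℝ) (0 + 1)) : ℝ) :=
      measurable_subtype_coe.comp (AddCircle.measurableEquivIco 1 0).measurable
    exact (measurable_nextVisit α z).comp h1 hF
  have hSinv : (fun y => (α : AddCircle (1 : ℝ)) + y) ⁻¹' S = S := by
    ext y
    induction y using QuotientAddGroup.induction_on with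
    | H x =>
      have : (α : AddCircle (1 : ℝ)) + (x : AddCircle (1 : ℝ)) = ((x + α : ℝ) : AddCircle (1 : ℝ)) := by
        rw [add_comm]; rfl
      rw [mem_preimage]
      refine Iff.trans ?_ (hSmem x).symm
      rw [← hstep x]
      rw [← hSmem (x + α), ← this]
  have herg : Ergodic (fun y => (α : AddCircle (1 : ℝ)) + y) := by
    rw [AddCircle.ergodic_add_left, addOrderOf_eq_zero_iff,
      AddCircle.not_isOfFinAddOrder_iff_forall_rat_ne_div]
    intro r hr
    rw [div_one] at hr
    exact hα ⟨r, hr⟩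
  have hmk := AddCircle.measurePreserving_mk (1 : ℝ) 0
  rw [zero_add] at hmk
  have hJae : ∀ P : ℝ → Prop, (∀ᵐ x ∂(volume.restrict (Ioc (0 : ℝ) 1)), P x) →
      ∀ᵐ x ∂lebJ z, P x := by
    intro P hP
    rw [ae_iff] at hP ⊢
    rw [lebJ_apply]
    have : volume (Ico 0 z ∩ {a | ¬ P a}) = 0 := by
      rw [← Measure.restrict_congr_set (Ico_ae_eq_Ioc (μ := volume) (a := (0 : ℝ)) (b := 1))] at hP
      refine le_antisymm ((measure_mono ?_).trans ((Measure.le_restrict_apply _ _).trans hP.le)) zero_le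
      rintro x ⟨hx, hx'⟩
      exact ⟨hx', hx.1, hx.2.trans_le h.le_one⟩
    rw [this, mul_zero]
  have key : ∀ x ∈ Ico 0 z, nextVisit α z x = x := fun x hx => by
    have := fract_eq_self_of_mem h.le_one hx
    rw [nextVisit, if_pos (by rw [this]; exact hx.2), this]
  rw [eventuallyConst_set]
  rcases herg.toPreErgodic.ae_mem_or_ae_notMem hSm hSinv with hS | hS
  · left
    have h1 := hJae _ (hmk.quasiMeasurePreserving.ae hS)
    filter_upwards [h1, ae_lebJ_mem z] with x hx hxJ
    rw [hSmem, key x hxJ] at hx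
    exact hx
  · right
    have h1 := hJae _ (hmk.quasiMeasurePreserving.ae hS)
    filter_upwards [h1, ae_lebJ_mem z] with x hx hxJ
    rw [hSmem, key x hxJ] at hx
    exact hx

end IsInducedRotation

end InducedRotation

section ReturnLabels

/-- A number `r` with `r * d` slightly above the expected number `q * z` of visits. -/
noncomputable def returnIndex (z : ℝ) (d q : ℕ) : ℕ := ⌈(q * z + 3) / d⌉₊

/-- The delay of `T^[returnIndex z d q * (m * d)]` with respect to the rotation by `m * q * α`. -/
noncomputable def returnLabel (α z : ℝ) (m d q : ℕ) (x : ℝ) : ℕ :=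
  returnIndex z d q * (m * d) - hits α z (m * q) x

theorem measurable_returnLabel (α z : ℝ) (m d q : ℕ) : Measurable (returnLabel α z m d q) :=
  measurable_from_top.comp (measurable_hits α z (m * q)) (g := fun k => returnIndex z d q * (m * d) - k)

namespace GoodScale

variable {α z κ : ℝ} {q : ℕ} {p : ℤ}

theorem hits_le (h : GoodScale α z κ q p) (h0 : 0 ≤ z) (h1 : z ≤ 1) {d : ℕ} (hd : 0 < d) (m : ℕ)
    (x : ℝ) : hits α z (m * q) x ≤ returnIndex z d q * (m * d) := by
  have hDK := (abs_le.1 (abs_hits_mul_sub_le h.pos h.coprime h.upper h0 h1 m x)).2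
  have hr : (q * z + 3) / d ≤ returnIndex z d q := Nat.le_ceil _
  have hd' : (0 : ℝ) < d := by exact_mod_cast hd
  rw [div_le_iff₀ hd'] at hr
  have : (hits α z (m * q) x : ℝ) ≤ returnIndex z d q * (m * d) := by
    have hm : (0 : ℝ) ≤ m := by positivity
    nlinarith
  exact_mod_cast this

theorem returnLabel_add_hits (h : GoodScale α z κ q p) (h0 : 0 ≤ z) (h1 : z ≤ 1) {d : ℕ}
    (hd : 0 < d) (m : ℕ) (x : ℝ) :
    returnLabel α z m d q x + hits α z (m * q) x = returnIndex z d q * (m * d) := by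
  have := h.hits_le h0 h1 hd m x
  unfold returnLabel
  omega

theorem returnLabel_le (h : GoodScale α z κ q p) (h0 : 0 ≤ z) (h1 : z ≤ 1) {d : ℕ} (hd : 0 < d)
    (m : ℕ) (x : ℝ) : returnLabel α z m d q x ≤ m * (6 + d) := by
  have hDK := (abs_le.1 (abs_hits_mul_sub_le h.pos h.coprime h.upper h0 h1 m x)).1
  have hd' : (0 : ℝ) < d := by exact_mod_cast hd
  have hr : (returnIndex z d q : ℝ) < (q * z + 3) / d + 1 :=
    Nat.ceil_lt_add_one (by positivity)
  have hr' : (returnIndex z d q : ℝ) * d ≤ q * z + 3 + d := by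
    calc (returnIndex z d q : ℝ) * d ≤ ((q * z + 3) / d + 1) * d := by gcongr
      _ = q * z + 3 + d := by field_simp
  have hsum : (returnLabel α z m d q x : ℝ) + hits α z (m * q) x =
      returnIndex z d q * (m * d) := by exact_mod_cast h.returnLabel_add_hits h0 h1 hd m x
  have : (returnLabel α z m d q x : ℝ) ≤ m * (6 + d) := by
    have hm : (0 : ℝ) ≤ m := by positivity
    nlinarith
  exact_mod_cast this

end GoodScale

theorem volume_real_Ico_inter_shift_le (z s : ℝ) :
    volume.real (Ico 0 z ∩ {x | x + s ∉ Ico 0 z}) ≤ 2 * |s| := by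
  have hsub : Ico 0 z ∩ {x | x + s ∉ Ico 0 z} ⊆ Ico (z - |s|) z ∪ Ico 0 |s| := by
    rintro x ⟨hx, hx'⟩
    by_contra hcon
    simp only [mem_union, mem_Ico, not_or, not_and_or, not_le, not_lt] at hcon
    apply hx'
    have := hx.1
    have := hx.2
    have := neg_abs_le s
    have := le_abs_self s
    constructor <;> rcases hcon with ⟨h1 | h1, h2 | h2⟩ <;> linarith
  refine (measureReal_mono hsub (by
    refine ((measure_union_le _ _).trans_lt ?_).ne
    simp [Real.volume_Ico])).trans ((measureReal_union_le _ _).trans ?_)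
  rw [Real.volume_real_Ico_of_le (by linarith [abs_nonneg s]), Real.volume_real_Ico_of_le (abs_nonneg s)]
  linarith

theorem volume_real_fract_lt_le {w : ℝ} (h0 : 0 ≤ w) (h1 : w ≤ 1) (b : ℝ) :
    volume.real ({x | Int.fract (x + b) < w} ∩ Ico 0 1) ≤ w := by
  rw [Measure.real, volume_fract_lt h1, ENNReal.toReal_ofReal h0]

namespace IsInducedRotation

variable {α z : ℝ} {T : ℝ → ℝ}

theorem tendsto_nextVisit (h : IsInducedRotation α z T) {ι : Type*} {l : Filter ι} {s : ι → ℝ}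
    (hs : Tendsto s l (nhds 0)) {B : Set ℝ} (hB : MeasurableSet B) :
    Tendsto (fun i => (lebJ z).real {x | ¬ (nextVisit α z (x + s i) ∈ B ↔ x ∈ B)}) l (nhds 0) := by
  let f : ℝ → C(ℝ, ℝ) := fun a => ⟨fun x => x + a, by fun_prop⟩
  have hf : Continuous f := ContinuousMap.continuous_of_continuous_uncurry _ (by
    show Continuous fun p : ℝ × ℝ => p.2 + p.1
    fun_prop)
  have hmp : ∀ a, MeasurePreserving (f a) volume volume := fun a => measurePreserving_add_right _ a
  have hf0 : Tendsto (fun i => f (s i)) l (nhds (f 0)) := (hf.tendsto 0).comp hs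
  have key : ∀ D : Set ℝ, MeasurableSet D → volume D ≠ ⊤ →
      Tendsto (fun i => volume.real (symmDiff (f (s i) ⁻¹' D) (f 0 ⁻¹' D))) l (nhds 0) := by
    intro D hD hDfin
    have := tendsto_measure_symmDiff_preimage_nhds_zero hf0 (Eventually.of_forall fun i => hmp _)
      (hmp 0) hD.nullMeasurableSet hDfin
    exact (ENNReal.tendsto_toReal ENNReal.zero_ne_top).comp this
  have hfinJ : volume (Ico 0 z) ≠ ⊤ := by rw [Real.volume_Ico]; exact ENNReal.ofReal_ne_top
  have h1 := key (Ico 0 z) measurableSet_Ico hfinJ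
  have h2 := key (Ico 0 z ∩ B) (measurableSet_Ico.inter hB)
    (ne_top_of_le_ne_top hfinJ (measure_mono inter_subset_left))
  have h3 := (h1.add h2).const_mul z⁻¹
  rw [add_zero, mul_zero] at h3
  refine squeeze_zero (fun i => measureReal_nonneg) (fun i => ?_) h3
  rw [lebJ_real h.pos]
  refine mul_le_mul_of_nonneg_left ?_ (inv_nonneg.2 h.pos.le)
  have hfin : ∀ D : Set ℝ, MeasurableSet D → volume D ≠ ⊤ →
      volume (symmDiff (f (s i) ⁻¹' D) (f 0 ⁻¹' D)) ≠ ⊤ := by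
    intro D hDm hD
    refine ne_top_of_le_ne_top (measure_union_ne_top (?_ : volume (f (s i) ⁻¹' D) ≠ ⊤) ?_)
      (measure_mono symmDiff_subset_union)
    · rwa [(hmp _).measure_preimage hDm.nullMeasurableSet]
    · rwa [(hmp _).measure_preimage hDm.nullMeasurableSet]
  refine (measureReal_mono ?_ ?_).trans (measureReal_union_le _ _)
  · rintro x ⟨hx, hx'⟩
    have e0 : ∀ D : Set ℝ, x ∈ f 0 ⁻¹' D ↔ x ∈ D := fun D => by simp [f]
    by_cases hxs : x + s i ∈ Ico 0 z
    · right
      have hn : nextVisit α z (x + s i) = x + s i := by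
        have := fract_eq_self_of_mem h.le_one hxs
        rw [nextVisit, if_pos (by rw [this]; exact hxs.2), this]
      rw [mem_ofPred_eq, hn] at hx'
      by_cases hxB : x ∈ B
      · exact Or.inr ⟨(e0 _).2 ⟨hx, hxB⟩, fun hcon => hx' ⟨fun _ => hxB, fun _ => hcon.2⟩⟩
      · refine Or.inl ⟨⟨hxs, ?_⟩, fun hcon => hxB ((e0 _).1 hcon).2⟩
        by_contra hcon
        exact hx' ⟨fun hc => absurd hc hcon, fun hc => absurd hc hxB⟩
    · left
      exact Or.inr ⟨(e0 _).2 hx, hxs⟩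
  · exact measure_union_ne_top (hfin _ measurableSet_Ico hfinJ)
      (hfin _ (measurableSet_Ico.inter hB) (ne_top_of_le_ne_top hfinJ (measure_mono inter_subset_left)))

/-- Except on a small set, the number of visits during time `N` is invariant under `T`. -/
theorem real_hits_ne_le (h : IsInducedRotation α z T) (N : ℕ) (l : ℤ) (hs : |N * α - l| ≤ 1) :
    (lebJ z).real {x | hits α z N (T x) ≠ hits α z N x} ≤ z⁻¹ * (4 * |N * α - l|) := by
  rw [lebJ_real h.pos]
  refine mul_le_mul_of_nonneg_left ?_ (inv_nonneg.2 h.pos.le)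
  obtain ⟨σ, -, hj⟩ := exists_jump_eq (N * α - l)
  set s := (N : ℝ) * α - l with hsdef
  set c := max s 0
  let Z : ℝ → Set ℝ := fun b => {x | Int.fract (x + b) < |s|} ∩ Ico 0 1
  have hZ : ∀ b, volume.real (Z b) ≤ |s| := fun b => volume_real_fract_lt_le (abs_nonneg s) hs b
  have hZfin : ∀ b, volume (Z b) ≠ ⊤ := fun b => by
    simp only [Z]; rw [volume_fract_lt hs]; exact ENNReal.ofReal_ne_top
  have hsub : Ico 0 z ∩ {x | hits α z N (T x) ≠ hits α z N x} ⊆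
      (Z c ∪ Z (α + c)) ∪ (Z (-z + c) ∪ Z (-z + α + c)) := by
    rintro x ⟨hx, hx'⟩
    have hx1 : x ∈ Ico (0 : ℝ) 1 := ⟨hx.1, hx.2.trans_le h.le_one⟩
    by_contra hcon
    simp only [mem_union, not_or] at hcon
    have hz : ∀ b, x ∉ Z b → arc |s| (x + b) = 0 := by
      intro b hb
      rw [arc_eq (abs_nonneg s) hs, if_neg]
      exact fun hlt => hb ⟨hlt, hx1⟩
    have z1 := hz _ hcon.1.1
    have z2 := hz _ hcon.1.2
    have z3 := hz _ hcon.2.1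
    have z4 := hz _ hcon.2.2
    obtain ⟨L, hL1, hL2, hL⟩ := h.exists_iterate_eq hx 1
    apply hx'
    rw [Function.iterate_one] at hL
    rw [hL, hits_fract]
    have hsh := hits_shift h.pos.le h.le_one α N L l x
    have hzero : ∀ t ∈ Finset.range L, jump s (x + t * α) = 0 ∧ jump s (x - z + t * α) = 0 := by
      intro t ht
      rw [Finset.mem_range] at ht
      rw [hj, hj]
      have ht2 : t = 0 ∨ t = 1 := by omega
      rcases ht2 with rfl | rfl
      · push_cast
        rw [zero_mul, add_zero, add_zero, show x - z + c = x + (-z + c) by ring, z1, z3]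
        simp
      · push_cast
        rw [one_mul, show x + α + c = x + (α + c) by ring,
          show x - z + α + c = x + (-z + α + c) by ring, z2, z4]
        simp
    rw [← hsdef, Finset.sum_eq_zero fun t ht => (hzero t ht).1,
      Finset.sum_eq_zero fun t ht => (hzero t ht).2] at hsh
    omega
  refine (measureReal_mono hsub (measure_union_ne_top (measure_union_ne_top (hZfin _) (hZfin _))
    (measure_union_ne_top (hZfin _) (hZfin _)))).trans ?_
  refine (measureReal_union_le _ _).trans ((add_le_add (measureReal_union_le _ _)
    (measureReal_union_le _ _)).trans ?_)
  linarith [hZ c, hZ (α + c), hZ (-z + c), hZ (-z + α + c)]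

/-- At a good scale `q`, the visits during time `q` change by one in a window `w` with a
probability of order `w / q`. -/
theorem le_real_hits_change (h : IsInducedRotation α z T) {κ : ℝ} {q : ℕ} {p : ℤ} (hκ : 0 < κ)
    (hκ1 : κ < 1) (hg : GoodScale α z κ q p) {w : ℕ} (hw : 2 * (w : ℝ) ≤ κ * q) :
    ((w : ℝ) - 1) * |q * α - p| / 2 ≤
      (lebJ z).real {x | |(hits α z q (T^[w] x) : ℤ) - hits α z q x| = 1} := by
  have hpos := hg.abs_pos hκ
  have hq : (1 : ℝ) ≤ q := by exact_mod_cast hg.pos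
  have hδ1 : |q * α - p| ≤ 1 := by nlinarith [hg.upper]
  set δ := |q * α - p| with hδ
  set c := max (q * α - p) 0 with hc
  let Z : ℕ → Set ℝ := fun t => {x | Int.fract (x + (t * α + c)) < δ}
  have hZm : ∀ t, MeasurableSet (Z t) := fun t =>
    measurableSet_lt (measurable_fract.comp (measurable_id.add_const _)) measurable_const
  have hZv : ∀ t, volume (Z t ∩ Ico 0 1) = ENNReal.ofReal δ := fun t => volume_fract_lt hδ1 _
  let H : Set ℝ := ⋃ t ∈ Finset.range w, Z t
  have hHm : MeasurableSet H := Finset.measurableSet_biUnion _ fun t _ => hZm t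
  have hHv : volume.real (H ∩ Ico 0 1) = w * δ := by
    have e : H ∩ Ico 0 1 = ⋃ t ∈ Finset.range w, (Z t ∩ Ico 0 1) := by
      simp only [H, iUnion_inter]
    rw [e, measureReal_biUnion_finset (h := fun t _ => by rw [hZv]; exact ENNReal.ofReal_ne_top)]
    · simp [Measure.real, hZv, ENNReal.toReal_ofReal hpos.le]
    · intro t ht t' ht' hne
      refine disjoint_left.2 fun x hx hx' => ?_
      have h1 : Int.fract (x + (t * α + c)) < δ := hx.1
      have h2 : Int.fract (x + (t' * α + c)) < δ := hx'.1
      have h3 := Int.fract_nonneg (x + (t * α + c))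
      have h4 := Int.fract_nonneg (x + (t' * α + c))
      rw [Finset.mem_coe, Finset.mem_range] at ht ht'
      have hgap := hg.gap (t - t') (⌊x + (t * α + c)⌋ - ⌊x + (t' * α + c)⌋)
        (sub_ne_zero.2 (by exact_mod_cast hne)) (by
          have a1 : (t : ℝ) < w := by exact_mod_cast ht
          have a2 : (t' : ℝ) < w := by exact_mod_cast ht'
          have a3 : (0 : ℝ) ≤ t := by positivity
          have a4 : (0 : ℝ) ≤ t' := by positivity
          push_cast
          rw [abs_lt]; constructor <;> nlinarith)
      push_cast at hgap
      rw [show ((t : ℝ) - t') * α - (⌊x + (t * α + c)⌋ - ⌊x + (t' * α + c)⌋) =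
        Int.fract (x + (t * α + c)) - Int.fract (x + (t' * α + c)) by
          rw [Int.fract, Int.fract]; ring] at hgap
      have : |Int.fract (x + (t * α + c)) - Int.fract (x + (t' * α + c))| < δ := by
        rw [abs_lt]; constructor <;> linarith
      exact absurd this (not_lt.2 hgap)
    · exact fun t _ => (hZm t).inter measurableSet_Ico
  set G : Set ℝ := {y | Int.fract y < z} with hG
  have hGm : MeasurableSet G := measurableSet_lt measurable_fract measurable_const
  have hGJ : G ∩ Ico 0 1 = Ico 0 z := by
    ext x
    constructor
    · rintro ⟨hx, h0, h1⟩
      rw [hG, mem_ofPred_eq, Int.fract_eq_self.2 ⟨h0, h1⟩] at hx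
      exact ⟨h0, hx⟩
    · intro hx
      refine ⟨?_, hx.1, hx.2.trans_le h.le_one⟩
      rw [hG, mem_ofPred_eq, fract_eq_self_of_mem h.le_one hx]
      exact hx.2
  have hGH : volume ((fun x => x + α) ⁻¹' (G ∩ H) ∩ Ico 0 1) = volume (Ico 0 z ∩ H) := by
    rw [volume_preimage_add_periodic (hGm.inter hHm)]
    · rw [← hGJ, inter_right_comm]
    · intro x
      refine and_congr (fract_add_one_iff (fun y => y < z) x) ?_
      simp only [H, mem_iUnion, Z, mem_ofPred_eq]
      refine exists_congr fun t => exists_congr fun _ => ?_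
      rw [show x + 1 + (t * α + c) = x + (t * α + c) + 1 by ring, Int.fract_add_one]
  have hfin1 : ∀ S : Set ℝ, volume (S ∩ Ico 0 1) ≠ ⊤ := fun S =>
    ne_top_of_le_ne_top (b := volume (Ico (0 : ℝ) 1)) (by simp) (measure_mono inter_subset_right)
  have hfinJ : volume (Ico 0 z ∩ H) ≠ ⊤ := by rw [← hGH]; exact hfin1 _
  have hcover : H ∩ Ico 0 1 ⊆ ((Ico 0 z ∩ H) ∪ (fun x => x + α) ⁻¹' (G ∩ H) ∩ Ico 0 1) ∪
      (Z 0 ∩ Ico 0 1) := by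
    rintro x ⟨hx, hx1⟩
    by_cases hxG : x ∈ G
    · exact Or.inl (Or.inl ⟨by rw [← hGJ]; exact ⟨hxG, hx1⟩, hx⟩)
    · simp only [H, mem_iUnion, Finset.mem_range, exists_prop] at hx
      obtain ⟨t, ht, hxt⟩ := hx
      rcases t with _ | t
      · exact Or.inr ⟨hxt, hx1⟩
      · refine Or.inl (Or.inr ⟨⟨h.next x hxG, ?_⟩, hx1⟩)
        simp only [H, mem_iUnion, Finset.mem_range, exists_prop]
        refine ⟨t, by omega, ?_⟩
        simp only [Z, mem_ofPred_eq] at hxt ⊢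
        convert hxt using 2
        push_cast
        ring
  have hmeas : (w : ℝ) * δ ≤ 2 * volume.real (Ico 0 z ∩ H) + δ := by
    rw [← hHv]
    refine (measureReal_mono hcover (measure_union_ne_top (measure_union_ne_top hfinJ (hfin1 _))
      (hfin1 _))).trans ((measureReal_union_le _ _).trans
      (add_le_add ((measureReal_union_le _ _).trans ?_) ?_))
    · rw [two_mul]
      refine add_le_add le_rfl (le_of_eq ?_)
      rw [Measure.real, hGH, Measure.real]
    · rw [Measure.real, hZv, ENNReal.toReal_ofReal hpos.le]
  have hsub : Ico 0 z ∩ H ⊆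
      Ico 0 z ∩ {x | |(hits α z q (T^[w] x) : ℤ) - hits α z q x| = 1} := by
    rintro x ⟨hx, hxH⟩
    refine ⟨hx, ?_⟩
    simp only [H, mem_iUnion, Finset.mem_range, exists_prop] at hxH
    obtain ⟨t, ht, hxt⟩ := hxH
    obtain ⟨L, hL1, hL2, hL⟩ := h.exists_iterate_eq hx w
    rw [mem_ofPred_eq, hL, hits_fract]
    refine hg.abs_hits_shift_eq_one hκ h.pos.le h.le_one ?_ (lt_of_lt_of_le ht hL1) ?_
    · have : (L : ℝ) ≤ 2 * w := by exact_mod_cast hL2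
      linarith
    · rw [add_assoc]; exact hxt
  rw [lebJ_real h.pos]
  have hz1 : 1 ≤ z⁻¹ := (one_le_inv₀ h.pos).2 h.le_one
  have hle := measureReal_mono hsub (ne_top_of_le_ne_top
    (b := volume (Ico 0 z)) (by simp) (measure_mono inter_subset_left))
  have h0 : 0 ≤ volume.real
    (Ico 0 z ∩ {x | |(hits α z q (T^[w] x) : ℤ) - hits α z q x| = 1}) := measureReal_nonneg
  nlinarith

end IsInducedRotation

end ReturnLabels

section Disjointness

theorem tendsto_goodScale_error {α z κ : ℝ} {q : ℕ → ℕ} {p : ℕ → ℤ}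
    (hg : ∀ i, GoodScale α z κ (q i) (p i)) (hq : ∀ i, i < q i) (m : ℕ) :
    Tendsto (fun i => ((m * q i : ℕ) : ℝ) * α - ((m * p i : ℤ) : ℝ)) atTop (nhds 0) := by
  have h1 : Tendsto (fun i : ℕ => (m : ℝ) * (1 / ((i : ℝ) + 1))) atTop (nhds 0) := by
    simpa using tendsto_one_div_add_atTop_nhds_zero_nat.const_mul (m : ℝ)
  refine squeeze_zero_norm (fun i => ?_) h1
  rw [Real.norm_eq_abs, show ((m * q i : ℕ) : ℝ) * α - ((m * p i : ℤ) : ℝ) =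
    m * (q i * α - p i) by push_cast; ring, abs_mul, Nat.abs_cast]
  have hqi : (i : ℝ) + 1 ≤ q i := by exact_mod_cast hq i
  have hu := (hg i).upper
  gcongr
  rw [le_div_iff₀ (by positivity)]
  nlinarith [abs_nonneg (q i * α - p i)]

namespace IsInducedRotation

variable {α z κ : ℝ} {T : ℝ → ℝ} {q : ℕ → ℕ} {p : ℕ → ℤ}

theorem asymptoticReturn (h : IsInducedRotation α z T) (hg : ∀ i, GoodScale α z κ (q i) (p i))
    (hq : ∀ i, i < q i) {l : Filter ℕ} (hl : l ≤ atTop) (m : ℕ) {d : ℕ} (hd : 0 < d) :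
    AsymptoticReturn l (lebJ z) T (fun i => returnIndex z d (q i) * (m * d))
      (fun i => returnLabel α z m d (q i)) := by
  have hprob := isProbabilityMeasure_lebJ h.pos
  have hs := (tendsto_goodScale_error hg hq m).mono_left hl
  refine ⟨fun i => measurable_returnLabel _ _ _ _ _, fun A hA => ?_, ?_⟩
  · have hlim : Tendsto (fun i => ∑ a ∈ Finset.range (m * (6 + d) + 1), (lebJ z).real
        {x | ¬ (nextVisit α z (x + (((m * q i : ℕ) : ℝ) * α - ((m * p i : ℤ) : ℝ))) ∈ T^[a] ⁻¹' A ↔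
          x ∈ T^[a] ⁻¹' A)}) l (nhds 0) := by
      have h0 : (0 : ℝ) = ∑ a ∈ Finset.range (m * (6 + d) + 1), (0 : ℝ) := by simp
      rw [h0]
      exact tendsto_finsetSum _ fun a _ => h.tendsto_nextVisit hs ((h.meas.iterate a) hA)
    refine squeeze_zero (fun i => measureReal_nonneg) (fun i => ?_) hlim
    have hcompl : (lebJ z).real (Ico 0 z)ᶜ = 0 := by
      have h0 : lebJ z (Ico 0 z)ᶜ = 0 := mem_ae_iff.1 (ae_lebJ_mem z)
      rw [Measure.real, h0, ENNReal.toReal_zero]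
    have hsub : {x | ¬ (T^[returnIndex z d (q i) * (m * d)] x ∈ A ↔
        T^[returnLabel α z m d (q i) x] x ∈ A)} ⊆ (Ico 0 z)ᶜ ∪
        ⋃ a ∈ Finset.range (m * (6 + d) + 1),
        {x | ¬ (nextVisit α z (x + (((m * q i : ℕ) : ℝ) * α - ((m * p i : ℤ) : ℝ))) ∈ T^[a] ⁻¹' A ↔
          x ∈ T^[a] ⁻¹' A)} := by
      intro x hx
      by_cases hxJ : x ∈ Ico 0 z
      · right
        refine mem_biUnion (Finset.mem_coe.2 (Finset.mem_range.2
          (Nat.lt_succ_of_le ((hg i).returnLabel_le h.pos.le h.le_one hd m x)))) ?_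
        rw [mem_ofPred_eq, ← (hg i).returnLabel_add_hits h.pos.le h.le_one hd m x,
          Function.iterate_add_apply, h.iterate_hits hxJ] at hx
        have e : nextVisit α z (x + (((m * q i : ℕ) : ℝ) * α - ((m * p i : ℤ) : ℝ))) =
            nextVisit α z (x + ((m * q i : ℕ) : ℝ) * α) := by
          rw [← nextVisit_add_int α z _ (m * p i)]
          congr 1
          ring
        rw [mem_ofPred_eq, mem_preimage, mem_preimage, e]
        exact hx
      · exact Or.inl hxJ
    refine (measureReal_mono hsub).trans ((measureReal_union_le _ _).trans ?_)
    rw [hcompl, zero_add]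
    exact measureReal_biUnion_finset_le _ _
  · have h1 := (hs.abs.const_mul 4).const_mul z⁻¹
    rw [abs_zero, mul_zero, mul_zero] at h1
    refine squeeze_zero' (Eventually.of_forall fun i => measureReal_nonneg) ?_ h1
    have h2 := hs.abs.eventually (gt_mem_nhds (show |(0 : ℝ)| < 1 by simp))
    filter_upwards [h2] with i hi
    refine (measureReal_mono fun x hx => ?_).trans (h.real_hits_ne_le (m * q i) (m * p i) hi.le)
    intro hcon
    apply hx
    unfold returnLabel
    rw [hcon]

theorem eventually_le_real_hits_change (h : IsInducedRotation α z T) (hκ : 0 < κ) (hκ1 : κ < 1)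
    (hg : ∀ i, GoodScale α z κ (q i) (p i)) (hq : ∀ i, i < q i) {K K' : ℕ} (hK : 0 < K)
    (hKK : K ≤ K') :
    ∃ η : ℝ, 0 < η ∧ ∀ᶠ i in atTop, η ≤ (lebJ z).real
      {x | |(hits α z (q i) (T^[K * ⌊κ * q i / (2 * K')⌋₊] x) : ℤ) - hits α z (q i) x| = 1} := by
  have hK' : (0 : ℝ) < K' := by exact_mod_cast hK.trans_le hKK
  have hKR : (1 : ℝ) ≤ K := by exact_mod_cast hK
  have hKKR : (K : ℝ) ≤ K' := by exact_mod_cast hKK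
  refine ⟨κ ^ 2 * K / (8 * K'), by positivity, ?_⟩
  have hbig : ∀ᶠ i : ℕ in atTop, 8 * K' / κ ≤ (i : ℝ) :=
    (tendsto_natCast_atTop_atTop.eventually_ge_atTop _)
  filter_upwards [hbig] with i hi
  have hqi : (i : ℝ) + 1 ≤ q i := by exact_mod_cast hq i
  rw [div_le_iff₀ hκ] at hi
  have hqκ : 8 * (K' : ℝ) ≤ κ * q i := by nlinarith
  set y := κ * q i / (2 * K') with hy
  have hy0 : 0 ≤ y := by positivity
  have hy4 : 4 ≤ y := by rw [hy, le_div_iff₀ (by positivity)]; linarith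
  have hfl := Nat.floor_le hy0
  have hfl' := Nat.lt_floor_add_one y
  have hyK : 2 * (K' * y) = κ * q i := by rw [hy]; field_simp
  have hw : 2 * ((K * ⌊y⌋₊ : ℕ) : ℝ) ≤ κ * q i := by
    push_cast
    rw [← hyK]
    gcongr
  refine le_trans ?_ (h.le_real_hits_change hκ hκ1 (hg i) hw)
  have hlow := (hg i).lower
  set δ := |q i * α - p i|
  have hδ0 : 0 ≤ δ := abs_nonneg _
  have h1 : (K : ℝ) * y / 2 ≤ ((K * ⌊y⌋₊ : ℕ) : ℝ) - 1 := by
    push_cast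
    nlinarith
  have h2 : κ ^ 2 * K / (8 * K') ≤ (K * y / 2) * δ / 2 := by
    have e : (K : ℝ) * y / 2 * δ / 2 = (κ * K / (8 * K')) * (q i * δ) := by
      rw [hy]; field_simp; ring
    rw [e]
    calc κ ^ 2 * K / (8 * K') = (κ * K / (8 * K')) * κ := by ring
      _ ≤ _ := by gcongr
  refine h2.trans ?_
  gcongr

theorem ergodic_iterate (h : IsInducedRotation α z T) (hα : Irrational α) (hκ : 0 < κ)
    (hκ1 : κ < 1) (hg : ∀ i, GoodScale α z κ (q i) (p i)) (hq : ∀ i, i < q i) {k : ℕ}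
    (hk : 0 < k) : Ergodic T^[k] (lebJ z) := by
  have hprob := isProbabilityMeasure_lebJ h.pos
  have hret := h.asymptoticReturn hg hq (l := (hyperfilter ℕ : Filter ℕ)) Nat.hyperfilter_le_atTop
    1 hk
  simp only [one_mul] at hret
  obtain ⟨η, hη, hev⟩ := h.eventually_le_real_hits_change hκ hκ1 hg hq (K := 1) (K' := 1) one_pos
    le_rfl
  refine ergodic_iterate_of_return (h.ergodic hα) hret (E := 1 * (6 + k))
    (fun i x => (hg i).returnLabel_le h.pos.le h.le_one hk 1 x)
    (fun i => 1 * ⌊κ * q i / (2 * (1 : ℕ))⌋₊) hη ?_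
  refine (hev.filter_mono Nat.hyperfilter_le_atTop).mono fun i hi => hi.trans (measureReal_mono ?_)
  intro x hx
  rw [mem_ofPred_eq] at hx ⊢
  have e1 := (hg i).returnLabel_add_hits h.pos.le h.le_one hk 1 x
  have e2 := (hg i).returnLabel_add_hits h.pos.le h.le_one hk 1
    (T^[1 * ⌊κ * q i / (2 * (1 : ℕ))⌋₊] x)
  simp only [one_mul] at e1 e2 hx ⊢
  rcases (abs_eq (by norm_num)).1 hx with hx | hx <;> omega

/-- If visits during the times `a` and `a + b` are unchanged in a window for most points, then so
are visits during the time `b`. -/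
theorem real_hits_change_sub_le (h : IsInducedRotation α z T) (a b W : ℕ) (l : ℤ) :
    (lebJ z).real {x | hits α z b (T^[W] x) ≠ hits α z b x} ≤
      (lebJ z).real {x | hits α z a (T^[W] x) ≠ hits α z a x} +
      (lebJ z).real {x | hits α z (a + b) (T^[W] x) ≠ hits α z (a + b) x} +
      z⁻¹ * (4 * |a * α - l|) := by
  have hprob := isProbabilityMeasure_lebJ h.pos
  set s := (a : ℝ) * α - l with hs
  set Bb : Set ℝ := {x | hits α z b (T^[W] x) ≠ hits α z b x}
  set Ba : Set ℝ := {x | hits α z a (T^[W] x) ≠ hits α z a x}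
  set Bab : Set ℝ := {x | hits α z (a + b) (T^[W] x) ≠ hits α z (a + b) x}
  set C : Set ℝ := {x | x + s ∉ Ico 0 z}
  set C' : Set ℝ := {x | x + -s ∉ Ico 0 z}
  have hC : (lebJ z).real C ≤ z⁻¹ * (2 * |s|) := by
    rw [lebJ_real h.pos]
    exact mul_le_mul_of_nonneg_left (volume_real_Ico_inter_shift_le z s) (inv_nonneg.2 h.pos.le)
  have hCm : MeasurableSet C := ((measurable_id.add_const s) measurableSet_Ico).compl
  have hTC : (lebJ z).real (T^[W] ⁻¹' C) = (lebJ z).real C :=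
    (h.measurePreserving.iterate W).measureReal_preimage hCm.nullMeasurableSet
  have hsub : Ico 0 z ∩ Bb ⊆ (Ico 0 z ∩ C') ∪
      (fun x => x + -s) ⁻¹' (Ico 0 z ∩ (Ba ∪ Bab ∪ T^[W] ⁻¹' C)) := by
    rintro y ⟨hy, hyb⟩
    by_cases hx : y + -s ∈ Ico 0 z
    swap
    · exact Or.inl ⟨hy, hx⟩
    right
    refine ⟨hx, ?_⟩
    by_contra hcon
    simp only [mem_union, not_or] at hcon
    obtain ⟨⟨ha, hab⟩, hTc⟩ := hcon
    set x := y + -s with hxdef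
    simp only [Ba, Bab, C, mem_ofPred_eq, mem_preimage, not_not] at ha hab hTc
    set u := T^[W] x with hu
    have huJ : u ∈ Ico 0 z := h.iterate_mem hx W
    have key : ∀ v ∈ Ico 0 z, nextVisit α z v = v := fun v hv => by
      have := fract_eq_self_of_mem h.le_one hv
      rw [nextVisit, if_pos (by rw [this]; exact hv.2), this]
    have e1 : x + a * α = y + l := by rw [hxdef, hs]; ring
    have e2 : u + a * α = u + s + l := by rw [hs]; ring
    have e3 : T^[hits α z a x] x = y := by
      rw [h.iterate_hits hx, e1, nextVisit_add_int, key y hy]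
    have e4 : T^[hits α z a x] u = u + s := by
      rw [← ha, h.iterate_hits huJ, e2, nextVisit_add_int, key _ hTc]
    have e5 : T^[W] y = u + s := by
      rw [← e4, hu, ← e3, ← Function.iterate_add_apply, ← Function.iterate_add_apply, add_comm]
    apply hyb
    rw [e5]
    have e6 := hits_add α z a b x
    have e7 := hits_add α z a b u
    rw [e1, hits_add_int] at e6
    rw [e2, hits_add_int] at e7
    omega
  have hfinJ : ∀ S : Set ℝ, volume (Ico 0 z ∩ S) ≠ ⊤ := fun S =>
    ne_top_of_le_ne_top (b := volume (Ico 0 z)) (by simp) (measure_mono inter_subset_left)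
  have hvol : volume.real (Ico 0 z ∩ Bb) ≤ 2 * |s| +
      volume.real (Ico 0 z ∩ (Ba ∪ Bab ∪ T^[W] ⁻¹' C)) := by
    have hpre : volume.real ((fun x => x + -s) ⁻¹' (Ico 0 z ∩ (Ba ∪ Bab ∪ T^[W] ⁻¹' C))) =
        volume.real (Ico 0 z ∩ (Ba ∪ Bab ∪ T^[W] ⁻¹' C)) := by
      rw [Measure.real, measure_preimage_add_right, Measure.real]
    refine (measureReal_mono hsub (measure_union_ne_top (hfinJ _) ?_)).trans
      ((measureReal_union_le _ _).trans (add_le_add ?_ hpre.le))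
    · rw [measure_preimage_add_right]; exact hfinJ _
    · have := volume_real_Ico_inter_shift_le z (-s)
      rwa [abs_neg] at this
  have hz : 0 ≤ z⁻¹ := inv_nonneg.2 h.pos.le
  calc (lebJ z).real Bb = z⁻¹ * volume.real (Ico 0 z ∩ Bb) := lebJ_real h.pos _
    _ ≤ z⁻¹ * (2 * |s| + volume.real (Ico 0 z ∩ (Ba ∪ Bab ∪ T^[W] ⁻¹' C))) := by gcongr
    _ = z⁻¹ * (2 * |s|) + (lebJ z).real (Ba ∪ Bab ∪ T^[W] ⁻¹' C) := by
      rw [lebJ_real h.pos]; ring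
    _ ≤ z⁻¹ * (2 * |s|) + ((lebJ z).real Ba + (lebJ z).real Bab + z⁻¹ * (2 * |s|)) := by
      refine add_le_add le_rfl ((measureReal_union_le _ _).trans
        (add_le_add (measureReal_union_le _ _) ?_))
      rw [hTC]; exact hC
    _ = _ := by ring

theorem tendsto_hits_change_gcd (h : IsInducedRotation α z T)
    (hg : ∀ i, GoodScale α z κ (q i) (p i)) (hq : ∀ i, i < q i) {l : Filter ℕ} (hl : l ≤ atTop)
    (W : ℕ → ℕ) :
    ∀ m n : ℕ,
      Tendsto (fun i => (lebJ z).real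
        {x | hits α z (m * q i) (T^[W i] x) ≠ hits α z (m * q i) x}) l (nhds 0) →
      Tendsto (fun i => (lebJ z).real
        {x | hits α z (n * q i) (T^[W i] x) ≠ hits α z (n * q i) x}) l (nhds 0) →
      Tendsto (fun i => (lebJ z).real
        {x | hits α z (m.gcd n * q i) (T^[W i] x) ≠ hits α z (m.gcd n * q i) x}) l (nhds 0) := by
  have hsub : ∀ m k : ℕ,
      Tendsto (fun i => (lebJ z).real
        {x | hits α z (m * q i) (T^[W i] x) ≠ hits α z (m * q i) x}) l (nhds 0) →
      Tendsto (fun i => (lebJ z).real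
        {x | hits α z ((m + k) * q i) (T^[W i] x) ≠ hits α z ((m + k) * q i) x}) l (nhds 0) →
      Tendsto (fun i => (lebJ z).real
        {x | hits α z (k * q i) (T^[W i] x) ≠ hits α z (k * q i) x}) l (nhds 0) := by
    intro m k h1 h2
    have hs := (((tendsto_goodScale_error hg hq m).mono_left hl).abs.const_mul 4).const_mul z⁻¹
    rw [abs_zero, mul_zero, mul_zero] at hs
    have hsum := (h1.add h2).add hs
    rw [add_zero, add_zero] at hsum
    refine squeeze_zero (fun i => measureReal_nonneg) (fun i => ?_) hsum
    have := h.real_hits_change_sub_le (m * q i) (k * q i) (W i) (m * p i)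
    rw [← add_mul] at this
    exact this
  intro m n
  induction hN : m + n using Nat.strong_induction_on generalizing m n with
  | _ N ih =>
    intro h1 h2
    rcases Nat.eq_zero_or_pos m with rfl | hm
    · simpa using h2
    rcases Nat.eq_zero_or_pos n with rfl | hn
    · simpa using h1
    rcases le_total m n with hmn | hmn
    · obtain ⟨k, rfl⟩ := Nat.exists_eq_add_of_le hmn
      have := ih (m + k) (by omega) m k rfl h1 (hsub m k h1 h2)
      simpa using this
    · obtain ⟨k, rfl⟩ := Nat.exists_eq_add_of_le hmn
      have := ih (k + n) (by omega) k n rfl (hsub n k h2 h1) h2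
      simpa [Nat.gcd_add_self_left, add_comm] using this

/-- Distinct powers of a map with good scales are disjoint. -/
theorem disjointSystems_iterate (h : IsInducedRotation α z T) (hα : Irrational α) (hκ : 0 < κ)
    (hκ1 : κ < 1) (hg : ∀ i, GoodScale α z κ (q i) (p i)) (hq : ∀ i, i < q i) {M N : ℕ}
    (hM : 0 < M) (hMN : M < N) : DisjointSystems (lebJ z) (lebJ z) T^[M] T^[N] := by
  have hprob := isProbabilityMeasure_lebJ h.pos
  have hmp := h.measurePreserving
  have herg : ∀ k, 0 < k → Ergodic T^[k] (lebJ z) := fun k hk =>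
    h.ergodic_iterate hα hκ hκ1 hg hq hk
  have hN : 0 < N := hM.trans hMN
  refine disjointSystems_of_extreme hmp.measurable fun c hext => ?_
  by_contra hne
  have hc : IsCoupling (lebJ z) hmp.measurable M N c := hext.1
  obtain ⟨d, m, n, hd, hcop, hMd, hNd⟩ : ∃ d m n : ℕ, 0 < d ∧ Nat.Coprime m n ∧ M = m * d ∧
      N = n * d := by
    obtain ⟨m, n, hcop, h1, h2⟩ := Nat.exists_coprime M N
    exact ⟨M.gcd N, m, n, Nat.gcd_pos_of_pos_left _ hM, hcop, h1, h2⟩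
  have hm : 0 < m := Nat.pos_of_mul_pos_right (hMd ▸ hM)
  have hmn : m < n := by
    rw [hMd, hNd] at hMN
    exact Nat.lt_of_mul_lt_mul_right hMN
  have hle : (hyperfilter ℕ : Filter ℕ) ≤ atTop := Nat.hyperfilter_le_atTop
  have he := h.asymptoticReturn hg hq hle m hd
  have hf := h.asymptoticReturn hg hq hle n hd
  rw [← hMd] at he
  rw [← hNd] at hf
  have hE : ∀ i x, returnLabel α z m d (q i) x ≤ n * (6 + d) := fun i x =>
    ((hg i).returnLabel_le h.pos.le h.le_one hd m x).trans (by gcongr)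
  have hF : ∀ i x, returnLabel α z n d (q i) x ≤ n * (6 + d) := fun i x =>
    (hg i).returnLabel_le h.pos.le h.le_one hd n x
  have hlim : ∀ a b, a * N ≠ b * M → Tendsto (fun i => c (MSet.level (he.meas i) a)
      (MSet.level (hf.meas i) b)) (hyperfilter ℕ : Filter ℕ) (nhds 0) := fun a b hab =>
    IsCoupling.tendsto_level_zero hmp herg hM hN hext hne he hf hab
  let w₀ : ℕ → ℕ := fun i => ⌊κ * q i / (2 * (N * N : ℕ))⌋₊
  have hwin : ∀ i, 2 * (((N * N : ℕ) : ℝ) * w₀ i) ≤ κ * q i := by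
    intro i
    have hNN : (0 : ℝ) < ((N * N : ℕ) : ℝ) := by exact_mod_cast Nat.mul_pos hN hN
    have := Nat.floor_le (show 0 ≤ κ * q i / (2 * (N * N : ℕ)) by positivity)
    rw [le_div_iff₀ (by positivity)] at this
    linarith
  have hsmall : ∀ w : ℕ → ℕ, (∀ i, w i * N ≤ N * N * w₀ i) →
      ∀ᶠ i in (hyperfilter ℕ : Filter ℕ), ∀ᵐ x ∂lebJ z,
      |(returnLabel α z n d (q i) (T^[w i * N] x) : ℤ) - returnLabel α z n d (q i) x| < n := by
    intro w hw
    filter_upwards [hle (eventually_ge_atTop n)] with i hi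
    filter_upwards [ae_lebJ_mem z] with x hx
    obtain ⟨L, hL1, hL2, hL⟩ := h.exists_iterate_eq hx (w i * N)
    have hLq : (L : ℝ) ≤ κ * q i := by
      have h1 : (L : ℝ) ≤ 2 * ((w i * N : ℕ) : ℝ) := by exact_mod_cast hL2
      have h2 : ((w i * N : ℕ) : ℝ) ≤ ((N * N : ℕ) : ℝ) * w₀ i := by exact_mod_cast hw i
      linarith [hwin i]
    have hlt := (hg i).abs_hits_shift_lt hκ hκ1 h.pos.le h.le_one (n := n) (by omega)
      (hi.trans (hq i).le) hLq x
    have e1 := (hg i).returnLabel_add_hits h.pos.le h.le_one hd n x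
    have e2 := (hg i).returnLabel_add_hits h.pos.le h.le_one hd n (T^[w i * N] x)
    rw [← hits_fract, ← hL] at hlt
    rw [abs_lt] at hlt ⊢
    constructor <;> omega
  let W : ℕ → ℕ := fun i => M * N * w₀ i
  have hlabel : ∀ (k : ℕ) (i : ℕ), {x | hits α z (k * q i) (T^[W i] x) ≠ hits α z (k * q i) x} =
      {x | returnLabel α z k d (q i) (T^[W i] x) ≠ returnLabel α z k d (q i) x} := by
    intro k i
    ext x
    have e1 := (hg i).returnLabel_add_hits h.pos.le h.le_one hd k x
    have e2 := (hg i).returnLabel_add_hits h.pos.le h.le_one hd k (T^[W i] x)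
    rw [mem_ofPred_eq, mem_ofPred_eq]
    omega
  have hchange : ∀ k i, MeasurableSet
      {x | returnLabel α z k d (q i) (T^[W i] x) ≠ returnLabel α z k d (q i) x} := fun k i =>
    (measurableSet_eq_fun ((measurable_returnLabel α z k d (q i)).comp (h.meas.iterate (W i)))
      (measurable_returnLabel α z k d (q i))).compl
  have hm0 : Tendsto (fun i => (lebJ z).real
      {x | hits α z (m * q i) (T^[W i] x) ≠ hits α z (m * q i) x}) (hyperfilter ℕ : Filter ℕ)
      (nhds 0) := by
    have := hc.tendsto_window_zero hMd hNd hd (hm.trans hmn) hcop he.meas hf.meas hE hF hlim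
      (fun i => N * w₀ i) (hsmall _ fun i => le_of_eq (by ring))
      (fun i => ⟨_, hchange m i⟩) (fun _ => MSet.top) (by
        intro i x hx y _ hxe
        refine absurd hxe ?_
        have : N * w₀ i * M = W i := by simp only [W]; ring
        rw [this]
        exact hx)
    refine this.congr fun i => ?_
    rw [hc.left, hlabel]
  have hn0 : Tendsto (fun i => (lebJ z).real
      {x | hits α z (n * q i) (T^[W i] x) ≠ hits α z (n * q i) x}) (hyperfilter ℕ : Filter ℕ)
      (nhds 0) := by
    have := hc.tendsto_window_zero hMd hNd hd (hm.trans hmn) hcop he.meas hf.meas hE hF hlim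
      (fun i => M * w₀ i) (hsmall _ fun i => by
        have : M * w₀ i * N = M * (N * w₀ i) := by ring
        rw [this, mul_assoc]
        gcongr)
      (fun _ => MSet.top) (fun i => ⟨_, hchange n i⟩) (by
        intro i x _ y hy _
        have : M * w₀ i * N = W i := by simp only [W]; ring
        rw [this]
        exact hy)
    refine this.congr fun i => ?_
    rw [hc.right, hlabel]
  have h1 := h.tendsto_hits_change_gcd hg hq hle W m n hm0 hn0
  rw [hcop] at h1
  obtain ⟨η, hη, hev⟩ := h.eventually_le_real_hits_change hκ hκ1 hg hq (K := M * N) (K' := N * N)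
    (Nat.mul_pos hM hN) (by gcongr)
  obtain ⟨i, hi1, hi2⟩ := ((hev.filter_mono hle).and (h1.eventually (gt_mem_nhds hη))).exists
  refine absurd (hi1.trans (measureReal_mono ?_)) (not_le.2 hi2)
  intro x hx
  rw [mem_ofPred_eq] at hx ⊢
  rw [one_mul]
  intro hcon
  simp only [W, w₀] at hcon
  rw [hcon, sub_self, abs_zero] at hx
  exact absurd hx (by norm_num)

end IsInducedRotation

theorem measurable_ietMap {d : ℕ} (π : Equiv.Perm (Fin d)) (len : Fin d → ℝ) :
    Measurable (ietMap π len) := by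
  unfold ietMap
  refine measurable_id.add (Finset.measurable_sum _ fun j _ => ?_)
  exact measurable_const.indicator measurableSet_Ico

theorem IsInducedMap.isInducedRotation {α z : ℝ} {T : ℝ → ℝ} (hz : 0 < z) (hz1 : z ≤ 1)
    (hTm : Measurable T) (hT : IsInducedMap (rot α) (Ico 0 z) T)
    (hJ : ∀ x ∈ Ico (0 : ℝ) 1, x ∉ Ico 0 z → rot α x ∈ Ico 0 z) : IsInducedRotation α z T := by
  have hnext : ∀ y, ¬ Int.fract y < z → Int.fract (y + α) < z := by
    intro y hy
    have := hJ (Int.fract y) ⟨Int.fract_nonneg _, Int.fract_lt_one _⟩ fun hcon => hy hcon.2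
    rw [rot, fract_fract_add] at this
    exact this.2
  refine ⟨hz, hz1, hnext, fun x hx => ?_, hTm⟩
  obtain ⟨n, hn, hfirst, hret, heq⟩ := hT x hx
  rw [heq, nextVisit]
  split_ifs with hy
  · have hn1 : n = 1 := by
      by_contra hne
      exact hfirst 1 one_pos (by omega) ⟨Int.fract_nonneg _, hy⟩
    rw [hn1]; rfl
  · have h2 : (rot α)^[2] x = Int.fract (x + α + α) := by
      rw [Function.iterate_succ_apply', Function.iterate_one, rot, rot, fract_fract_add]
    have hn1 : n ≠ 1 := by
      rintro rfl
      exact hy hret.2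
    have hn2 : n = 2 := by
      by_contra hne
      refine hfirst 2 two_pos (by omega) ?_
      rw [h2]
      exact ⟨Int.fract_nonneg _, hnext _ hy⟩
    rw [hn2, h2]

end Disjointness

theorem theorem1p7 (π : Equiv.Perm (Fin 3)) (len : Fin 3 → ℝ) (hlen : ∀ j, 0 < len j)
    (α z : ℝ) (hα : Irrational α) (hz : z = ∑ j, len j) (hz1 : z ≤ 1)
    (hT : IsInducedMap (rot α) (Set.Ico 0 z) (ietMap π len))
    (hJ : ∀ x ∈ Set.Ico (0 : ℝ) 1, x ∉ Set.Ico 0 z → rot α x ∈ Set.Ico 0 z)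
    (hA : SatisfiesA α z) :
    ∃ κ : ℝ, 1 < κ ∧ ∀ n : ℕ, 0 < n →
      ∀ m₁ ∈ nonDisjointPowers z (ietMap π len) n,
      ∀ m₂ ∈ nonDisjointPowers z (ietMap π len) n,
        m₁ < m₂ → κ < (m₂ : ℝ) / (m₁ : ℝ) := by
  have hz0 : 0 < z := by
    rw [hz]; exact Finset.sum_pos (fun j _ => hlen j) Finset.univ_nonempty
  have h := hT.isInducedRotation hz0 hz1 (measurable_ietMap π len) hJ
  obtain ⟨κ, hκ, hκ1, hscale⟩ := hA.exists_goodScale hα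
  choose q p hq hg using hscale
  refine ⟨2, one_lt_two, fun n _ m₁ hm₁ => ?_⟩
  exact absurd (h.disjointSystems_iterate hα hκ hκ1 hg hq hm₁.1 hm₁.2.1) hm₁.2.2
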